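/- Let $p,q,a,b,c,d,e$ be complex numbers with $|p|<1$, $q\neq0$ and $a\neq 0$, and let $n$ be a nonnegative integer. For $x\ne 0$ put $$E(x)=\prod_{k=0}^{\infty}(1-xp^k)(1-p^{k+1}/x),$$ and for $k\ge 0$ put $(x;q,p)_k=\prod_{j=0}^{k-1}E(xq^j)$ and $(x_1,\dots,x_m;q,p)_k=(x_1;q,p)_k\cdots(x_m;q,p)_k$. Assume that $bc=aq$ and $de=aq^{n+1}$, and that none of the denominators occurring in the sum below vanishes, i.e. $E(a)\neq0$, $(q,aq/b,aq/c;q,p)_n\ne0$ and $(aq^2/d,aq^2/e,aq^{n+2};q^2,p)_n\neq0$. Then $$\sum_{k=0}^n \frac{E(aq^{3k})}{E(a)}\, \frac{(a,b,c;q^2,p)_k}{(q,aq/b,aq/c;q,p)_k}\, \frac{(d,e,q^{-n};q,p)_k}{(aq^2/d,aq^2/e,aq^{n+2};q^2,p)_k}\, q^k =\begin{cases}\displaystyle \frac{(aq^2,aq^2/bc,aq^2/bd,aq^2/cd;q^2,p)_{n/2}} {(aq^2/b,aq^2/c,aq^2/d,aq^2/bcd;q^2,p)_{n/2}} & \text{for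 $n$ even,} \\[3mm] 0 & \text{for $n$ odd.} \end{cases}$$ -/

import Mathlib

noncomputable section

/-- The infinite `q`-shifted factorial `(x; p)_∞ = ∏_{k ≥ 0} (1 - x p^k)`; the product converges
(absolutely) for `‖p‖ < 1`. -/
def shiftedFactInf (x p : ℂ) : ℂ := ∏' k : ℕ, (1 - x * p ^ k)

/-- The elliptic function `E(x; p) = (x; p)_∞ (p / x; p)_∞`, for `x ≠ 0` and `‖p‖ < 1`. -/
def ellE (x p : ℂ) : ℂ := shiftedFactInf x p * shiftedFactInf (p / x) p

/-- The elliptic shifted factorial `(a; q, p)_n = ∏_{k=0}^{n-1} E(a q^k; p)`, for `n ≥ 0`. -/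
def ellFact (a q p : ℂ) (n : ℕ) : ℂ := ∏ k ∈ Finset.range n, ellE (a * q ^ k) p

/-- Condensed notation `(a_1, …, a_m; q, p)_n = (a_1; q, p)_n ⋯ (a_m; q, p)_n`. -/
def ellFacts (l : List ℂ) (q p : ℂ) (n : ℕ) : ℂ := (l.map fun a => ellFact a q p n).prod

/-- The sum
`∑_{k=0}^n E(a q^{3k}) / E(a) * (a, b, c; q², p)_k / (q, aq/b, aq/c; q, p)_k
  * (d, e, q^{-n}; q, p)_k / (aq²/d, aq²/e, aq^{n+2}; q², p)_k * q^k`. -/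
def quadraticEllSum (a b c d e q p : ℂ) (n : ℕ) : ℂ :=
  ∑ k ∈ Finset.range (n + 1),
    ellE (a * q ^ (3 * k)) p / ellE a p
      * (ellFacts [a, b, c] (q ^ 2) p k / ellFacts [q, a * q / b, a * q / c] q p k)
      * (ellFacts [d, e, (q ^ n)⁻¹] q p k
          / ellFacts [a * q ^ 2 / d, a * q ^ 2 / e, a * q ^ (n + 2)] (q ^ 2) p k)
      * q ^ k

end

/-! The relations `b * c = a * q` and `d * e = a * q ^ (n + 1)` eliminate `c` and `e`; the identity
is then read as one between functions of `d`. After multiplication by `quadDenom`, both sides are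
combinations of products of `n` factors `E(dx) E(xl/d)` with `l = a * q ^ (n + 1)`
(`quadNumer_mem_thetaForms`, `quadValueNumer_mem_thetaForms`). The Jacobi triple product shows that
`E(xy) E(x/y)` has rank two (`exists_ellE_mul_ellE_div`), so such combinations are binary forms of
degree `n` in two fixed functions, and `n + 1` independent points determine them
(`eq_zero_of_mem_thetaForms`).

The points are `d = q^{-i}` for `i < n`, and `d = bq`. At `d = bq` the series collapses to a
telescoping bibasic sum, which vanishes for `n > 0` (`quadSum_mul_eq_zero`). At `d = q^{-i}` the sum
stops at `k = i` and is symmetric in `i` and `n` (`quadSum_swap`). If `n + i` is even, strong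
induction on `n` thus gives its value; if `n + i` is odd, every term of the cleared sum is zero.

This requires generic `a`, `b`, `q`. The general case follows by continuity along a curve on which
only countably many parameters are not generic (`countable_not_isGeneric`). -/

open Filter Topology

/-! ### Zeros, inversion and continuity of `E` -/

theorem summable_norm_mul_pow {p : ℂ} (hp : ‖p‖ < 1) (x : ℂ) : Summable fun k : ℕ => ‖-(x * p ^ k)‖ := by
  simp only [norm_neg, norm_mul, norm_pow]
  exact (summable_geometric_of_lt_one (norm_nonneg _) hp).mul_left _

theorem multipliable_one_sub_mul_pow {p : ℂ} (hp : ‖p‖ < 1) (x : ℂ) :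
    Multipliable fun k : ℕ => (1 - x * p ^ k) := by
  simpa only [sub_eq_add_neg] using multipliable_one_add_of_summable (summable_norm_mul_pow hp x)

theorem shiftedFactInf_eq_mul {p : ℂ} (hp : ‖p‖ < 1) (x : ℂ) :
    shiftedFactInf x p = (1 - x) * shiftedFactInf (p * x) p := by
  unfold shiftedFactInf
  rw [tprod_eq_zero_mul']
  · simp only [pow_zero, mul_one, pow_succ]
    congr 2
    ext k
    ring
  · have := multipliable_one_sub_mul_pow hp (p * x)
    convert! this using 2 with k
    ring

theorem exists_eq_of_shiftedFactInf_eq_zero {p x : ℂ} (hp : ‖p‖ < 1) (h : shiftedFactInf x p = 0) :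
    ∃ k : ℕ, x * p ^ k = 1 := by
  by_contra! hne
  refine (tprod_one_add_ne_zero_of_summable (f := fun k : ℕ => -(x * p ^ k)) (fun k => ?_)
    (summable_norm_mul_pow hp x)) (by simpa only [shiftedFactInf, sub_eq_add_neg] using h)
  rw [← sub_eq_add_neg, sub_ne_zero]
  exact (hne k).symm

theorem continuous_shiftedFactInf {p : ℂ} (hp : ‖p‖ < 1) : Continuous fun x => shiftedFactInf x p := by
  rw [continuous_iff_continuousAt]
  intro x₀
  have hK : IsOpen (Metric.ball (0 : ℂ) (‖x₀‖ + 1)) := Metric.isOpen_ball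
  have h := Summable.hasProdLocallyUniformlyOn_nat_one_add (f := fun (k : ℕ) (x : ℂ) => -(x * p ^ k))
    (u := fun k : ℕ => (‖x₀‖ + 1) * ‖p‖ ^ k) hK
    ((summable_geometric_of_lt_one (norm_nonneg _) hp).mul_left _)
    (Eventually.of_forall fun k x hx => by
      rw [norm_neg, norm_mul, norm_pow]
      have : ‖x‖ < ‖x₀‖ + 1 := by simpa using hx
      gcongr)
    (fun k => by fun_prop)
  rw [hasProdLocallyUniformlyOn_iff_tendstoLocallyUniformlyOn] at h
  have hc := h.continuousOn (Eventually.of_forall fun s => by fun_prop).frequently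
  have hx : x₀ ∈ Metric.ball (0 : ℂ) (‖x₀‖ + 1) := by simp
  have := hc.continuousAt (hK.mem_nhds hx)
  simpa only [shiftedFactInf, sub_eq_add_neg] using this

theorem ellE_one {p : ℂ} (hp : ‖p‖ < 1) : ellE 1 p = 0 := by
  rw [ellE, shiftedFactInf_eq_mul hp]; simp

theorem ellE_inv {p x : ℂ} (hp : ‖p‖ < 1) (hx : x ≠ 0) : ellE x⁻¹ p = -x⁻¹ * ellE x p := by
  rw [ellE, ellE, shiftedFactInf_eq_mul hp x, shiftedFactInf_eq_mul hp x⁻¹]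
  simp only [div_eq_mul_inv, inv_inv]
  field_simp
  ring

theorem ellE_zero_right (x : ℂ) : ellE x 0 = 1 - x := by
  have h : ∀ y : ℂ, shiftedFactInf y 0 = 1 - y := fun y => by
    rw [shiftedFactInf_eq_mul (by simp)]
    simp [shiftedFactInf]
  simp [ellE, h]

/-- The zeros lie among `p^{-k}` and `p^{k+1}`. Countability is all that the later density argument
needs. -/
theorem countable_ellE_eq_zero {p : ℂ} (hp : ‖p‖ < 1) : {x : ℂ | x ≠ 0 ∧ ellE x p = 0}.Countable := by
  refine ((Set.countable_range fun k : ℕ => (p ^ k)⁻¹).union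
    (Set.countable_range fun k : ℕ => p * p ^ k)).mono ?_
  rintro x ⟨hx, h⟩
  rcases mul_eq_zero.1 h with h | h
  · obtain ⟨k, hk⟩ := exists_eq_of_shiftedFactInf_eq_zero hp h
    exact Or.inl ⟨k, (eq_inv_of_mul_eq_one_left hk).symm⟩
  · obtain ⟨k, hk⟩ := exists_eq_of_shiftedFactInf_eq_zero hp h
    refine Or.inr ⟨k, ?_⟩
    field_simp at hk
    exact hk

theorem continuousAt_ellE {p x : ℂ} (hp : ‖p‖ < 1) (hx : x ≠ 0) : ContinuousAt (fun y => ellE y p) x := by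
  unfold ellE
  refine (continuous_shiftedFactInf hp).continuousAt.mul ?_
  exact ContinuousAt.comp (g := fun y => shiftedFactInf y p) (f := fun y => p / y) (continuous_shiftedFactInf hp).continuousAt
    (continuousAt_const.div continuousAt_id hx)

/-! ### The Jacobi triple product -/

/-- Gaussian binomial coefficients. -/
def gaussBinom (p : ℂ) : ℕ → ℕ → ℂ
  | _, 0 => 1
  | 0, _ + 1 => 0
  | N + 1, i + 1 => p ^ (i + 1) * gaussBinom p N (i + 1) + gaussBinom p N i

theorem gaussBinom_zero_right (p : ℂ) (N : ℕ) : gaussBinom p N 0 = 1 := by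
  cases N <;> rfl

theorem gaussBinom_eq_zero_of_lt (p : ℂ) {N i : ℕ} (h : N < i) : gaussBinom p N i = 0 := by
  induction N generalizing i with
  | zero => obtain ⟨i, rfl⟩ := Nat.exists_eq_succ_of_ne_zero h.ne'; rfl
  | succ N ih =>
    obtain ⟨i, rfl⟩ := Nat.exists_eq_succ_of_ne_zero (Nat.ne_of_gt (Nat.zero_lt_of_lt h))
    rw [gaussBinom, ih (by omega), ih (by omega)]
    simp

/-- The finite `q`-binomial theorem. -/
theorem prod_one_sub_mul_pow_eq_sum (p z : ℂ) (N : ℕ) :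
    ∏ k ∈ Finset.range N, (1 - z * p ^ k) =
      ∑ i ∈ Finset.range (N + 1), (-1) ^ i * p ^ (i.choose 2) * gaussBinom p N i * z ^ i := by
  induction N generalizing z with
  | zero => simp [gaussBinom_zero_right]
  | succ N ih =>
    -- The product without its factor `1 - z` is expanded twice, with and without a vanishing top
    -- term, so that its multiples by `1` and by `z` line up after an index shift.
    have h1 : ∏ k ∈ Finset.range N, (1 - z * p ^ (k + 1)) =
        ∑ i ∈ Finset.range (N + 1 + 1), (-1) ^ i * p ^ (i.choose 2) * gaussBinom p N i * (z * p) ^ i := by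
      rw [Finset.sum_range_succ _ (N + 1), gaussBinom_eq_zero_of_lt p (Nat.lt_succ_self N), ← ih]
      simp only [mul_zero, zero_mul, add_zero]
      exact Finset.prod_congr rfl fun k _ => by ring
    have h2 : ∏ k ∈ Finset.range N, (1 - z * p ^ (k + 1)) =
        ∑ i ∈ Finset.range (N + 1), (-1) ^ i * p ^ (i.choose 2) * gaussBinom p N i * (z * p) ^ i := by
      rw [← ih]
      exact Finset.prod_congr rfl fun k _ => by ring
    rw [Finset.prod_range_succ', pow_zero, mul_one, mul_sub, mul_one]
    nth_rewrite 2 [h2]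
    rw [h1, Finset.sum_range_succ', Finset.sum_range_succ' _ (N + 1), Finset.sum_mul, add_sub_right_comm,
      ← Finset.sum_sub_distrib]
    congr 1
    · refine Finset.sum_congr rfl fun i _ => ?_
      rw [gaussBinom, show (i + 1).choose 2 = i + i.choose 2 by
        rw [Nat.choose_succ_succ' i 1, Nat.choose_one_right]]
      ring
    · simp [gaussBinom_zero_right]

/-- The factorial quotient formula, cleared of denominators so that the Pascal recursion proves it
for every `p`. -/
theorem gaussBinom_mul (p : ℂ) (i j : ℕ) :
    gaussBinom p (i + j) i *
      ((∏ k ∈ Finset.range i, (1 - p * p ^ k)) * ∏ k ∈ Finset.range j, (1 - p * p ^ k)) =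
      ∏ k ∈ Finset.range (i + j), (1 - p * p ^ k) := by
  induction h : i + j generalizing i j with
  | zero =>
    obtain ⟨rfl, rfl⟩ : i = 0 ∧ j = 0 := by omega
    simp [gaussBinom_zero_right]
  | succ N ih =>
    rcases i with _ | i
    · obtain rfl : j = N + 1 := by omega
      simp [gaussBinom_zero_right]
    · rw [gaussBinom]
      have e1 := ih i j (by omega)
      rcases j with _ | j
      · obtain rfl : N = i := by omega
        rw [gaussBinom_eq_zero_of_lt p (Nat.lt_succ_self N), Finset.prod_range_succ _ N]
        linear_combination (1 - p * p ^ N) * e1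
      · have e2 := ih (i + 1) j (by omega)
        have hN : p ^ N = p ^ i * p ^ (j + 1) := by rw [← pow_add]; congr 1; omega
        rw [Finset.prod_range_succ _ j]
        rw [Finset.prod_range_succ _ i] at e2 ⊢
        rw [Finset.prod_range_succ _ j] at e1
        rw [Finset.prod_range_succ _ N, hN]
        linear_combination (p ^ (i + 1)) * (1 - p * p ^ j) * e2 + (1 - p * p ^ i) * e1

/-- The triangular number `j (j - 1) / 2`. -/
def tri (j : ℤ) : ℤ := j * (j - 1) / 2

theorem two_mul_tri (j : ℤ) : 2 * tri j = j * (j - 1) :=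
  Int.mul_ediv_cancel' (by simpa [mul_comm] using (Int.even_mul_pred_self j).two_dvd)

theorem tri_add (i j : ℤ) : tri (i + j) = tri i + tri j + i * j := by
  have h1 := two_mul_tri i
  have h2 := two_mul_tri j
  have h3 := two_mul_tri (i + j)
  linarith

theorem tri_natCast (i : ℕ) : tri i = (i.choose 2 : ℕ) := by
  induction i with
  | zero => rfl
  | succ i ih =>
    have : tri 1 = 0 := rfl
    push_cast
    rw [tri_add, ih, Nat.choose_succ_succ' i 1, Nat.choose_one_right, this]
    push_cast
    ring

theorem summable_pow_choose_mul_pow {r : ℝ} (hr : 0 < r) (hr1 : r < 1) {w : ℝ} (hw : 0 < w) :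
    Summable fun n : ℕ => r ^ (n.choose 2) * w ^ n := by
  have h0 : Tendsto (fun n : ℕ => r ^ n * w) atTop (𝓝 0) := by
    simpa using (tendsto_pow_atTop_nhds_zero_of_lt_one hr.le hr1).mul_const w
  refine summable_of_ratio_test_tendsto_lt_one zero_lt_one
    (Eventually.of_forall fun n => by positivity) (h0.congr fun n => ?_)
  rw [Real.norm_of_nonneg (by positivity), Real.norm_of_nonneg (by positivity),
    Nat.choose_succ_succ' n 1, Nat.choose_one_right, pow_add]
  field_simp
  ring

theorem tri_neg (j : ℤ) : tri (-j) = tri j + j := by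
  have h1 := two_mul_tri j
  have h2 := two_mul_tri (-j)
  linarith

/-- The summands of the theta series `∑ p ^ (j (j - 1) / 2) x ^ j`. -/
noncomputable def thetaTerm (p x : ℂ) (j : ℤ) : ℂ := p ^ tri j * x ^ j

theorem summable_norm_thetaTerm {p x : ℂ} (hp0 : p ≠ 0) (hp : ‖p‖ < 1) (hx : x ≠ 0) :
    Summable fun j => ‖thetaTerm p x j‖ := by
  have hp0' := norm_pos_iff.2 hp0
  have hx' := norm_pos_iff.2 hx
  refine Summable.of_nat_of_neg ?_ ?_
  · refine (summable_pow_choose_mul_pow hp0' hp hx').congr fun n => ?_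
    rw [thetaTerm, tri_natCast, norm_mul, norm_zpow, norm_zpow, zpow_natCast, zpow_natCast]
  · refine (summable_pow_choose_mul_pow hp0' hp (w := ‖p‖ * ‖x‖⁻¹) (by positivity)).congr fun n => ?_
    rw [thetaTerm, tri_neg, tri_natCast, norm_mul, norm_zpow, norm_zpow, zpow_add₀ hp0'.ne',
      zpow_natCast, zpow_natCast, zpow_neg, zpow_natCast, mul_pow, inv_pow]
    ring

theorem norm_sq_lt_one_of_norm_lt_one {p : ℂ} (hp : ‖p‖ < 1) : ‖p ^ 2‖ < 1 := by
  rw [norm_pow]; exact pow_lt_one₀ (norm_nonneg _) hp two_ne_zero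

/-- The normalised coefficients of the truncated triple product. -/
noncomputable def thetaCoeff (p : ℂ) (m : ℕ) (j : ℤ) : ℂ :=
  if j ∈ Finset.Icc (-m : ℤ) m then gaussBinom p (2 * m) (m + j).toNat else 0

theorem prod_neg_mul_zpow {p x : ℂ} (hp0 : p ≠ 0) (m : ℕ) :
    ∏ k ∈ Finset.range m, (-(x * (p ^ (k + 1))⁻¹)) = (-1) ^ m * x ^ m * p ^ (-tri (m + 1)) := by
  induction m with
  | zero => simp [tri]
  | succ m ih =>
    rw [Finset.prod_range_succ, ih]
    push_cast
    have : -tri ((m : ℤ) + 1 + 1) = - tri (m + 1) - ((m + 1 : ℕ) : ℤ) := by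
      rw [tri_add (m + 1) 1, show tri 1 = 0 from rfl]; push_cast; ring
    rw [this, zpow_sub₀ hp0, zpow_natCast]
    field_simp
    ring

/-- The finite form of the Jacobi triple product. -/
theorem prod_mul_prod_eq_tsum {p x : ℂ} (hp0 : p ≠ 0) (hx : x ≠ 0) (m : ℕ) :
    (∏ k ∈ Finset.range m, (1 - x * p ^ k)) * ∏ k ∈ Finset.range m, (1 - p / x * p ^ k) =
      ∑' j : ℤ, thetaTerm p (-x) j * thetaCoeff p m j := by
  have hC : (∏ k ∈ Finset.range m, (-(x * (p ^ (k + 1))⁻¹))) ≠ 0 :=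
    Finset.prod_ne_zero_iff.2 fun k _ => by simp [hx, hp0]
  -- With `z = x p^{-m}` and `2m` factors, the first `m`, taken in reverse order, are the factors `1
  -- - p^{k+1}/x` up to monomials; the last `m` are the factors `1 - x p^k`.
  have h1 := prod_one_sub_mul_pow_eq_sum p (x * (p ^ m)⁻¹) (2 * m)
  have h2 : ∏ k ∈ Finset.range (2 * m), (1 - x * (p ^ m)⁻¹ * p ^ k) =
      (∏ k ∈ Finset.range m, (-(x * (p ^ (k + 1))⁻¹))) *
      ((∏ k ∈ Finset.range m, (1 - x * p ^ k)) * ∏ k ∈ Finset.range m, (1 - p / x * p ^ k)) := by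
    rw [two_mul, Finset.prod_range_add, mul_left_comm (∏ k ∈ Finset.range m, (-(x * (p ^ (k + 1))⁻¹))),
      mul_comm (∏ k ∈ Finset.range m, (1 - x * p ^ k))]
    refine congrArg₂ (fun a b : ℂ => a * b) ?_ ?_
    · rw [← Finset.prod_range_reflect, ← Finset.prod_mul_distrib]
      refine Finset.prod_congr rfl fun k hk => ?_
      have hk := Finset.mem_range.1 hk
      have : p ^ m = p ^ (m - 1 - k) * p ^ (k + 1) := by rw [← pow_add]; congr 1; omega
      rw [this]
      field_simp
      ring
    · refine Finset.prod_congr rfl fun k _ => ?_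
      rw [pow_add]; field_simp
  rw [tsum_eq_sum (s := Finset.Icc (-m : ℤ) m) (fun j hj => by rw [thetaCoeff, if_neg hj, mul_zero])]
  refine mul_left_cancel₀ hC ?_
  rw [← h2, h1, Finset.mul_sum]
  refine Finset.sum_nbij' (fun i => (i : ℤ) - m) (fun j => (m + j).toNat) ?_ ?_ ?_ ?_ ?_
  · intro i hi; simp at hi ⊢; omega
  · intro j hj; simp at hj ⊢; omega
  · intro i hi; simp
  · intro j hj; simp at hj ⊢; omega
  · intro i hi
    rw [thetaCoeff, if_pos (by simp at hi ⊢; omega), thetaTerm, prod_neg_mul_zpow hp0,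
      show (m + ((i : ℤ) - m)).toNat = i by omega]
    have e : tri ((i : ℤ) - m) = (i.choose 2 : ℕ) + tri (m + 1) - ((i * m : ℕ) : ℤ) := by
      have := tri_natCast i
      have h1 := two_mul_tri i
      have h2 := two_mul_tri (m + 1)
      have h3 := two_mul_tri (i - m)
      push_cast
      rw [← this]
      linarith
    rw [e, zpow_sub₀ hp0, zpow_add₀ hp0, zpow_neg, zpow_natCast, zpow_natCast, zpow_sub₀ (neg_ne_zero.2 hx),
      zpow_natCast, zpow_natCast, mul_pow, inv_pow, ← pow_mul, mul_comm m i, neg_pow x i, neg_pow x m]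
    have : ((-1 : ℂ) ^ m) ≠ 0 := by simp
    field_simp

theorem tendsto_prod_shiftedFactInf {p : ℂ} (hp : ‖p‖ < 1) (x : ℂ) :
    Tendsto (fun m => ∏ k ∈ Finset.range m, (1 - x * p ^ k)) atTop (𝓝 (shiftedFactInf x p)) :=
  (multipliable_one_sub_mul_pow hp x).hasProd.tendsto_prod_nat

theorem one_sub_mul_pow_ne_zero {p : ℂ} (hp : ‖p‖ < 1) (k : ℕ) : 1 - p * p ^ k ≠ 0 := by
  rw [sub_ne_zero, ← pow_succ']
  intro h
  have := congrArg norm h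
  rw [norm_one, norm_pow] at this
  exact (pow_lt_one₀ (norm_nonneg _) hp k.succ_ne_zero).ne this.symm

theorem shiftedFactInf_self_ne_zero {p : ℂ} (hp : ‖p‖ < 1) : shiftedFactInf p p ≠ 0 := by
  intro h
  obtain ⟨k, hk⟩ := exists_eq_of_shiftedFactInf_eq_zero hp h
  exact one_sub_mul_pow_ne_zero hp k (by rw [hk, sub_self])

theorem thetaCoeff_eq {p : ℂ} (hp : ‖p‖ < 1) {m : ℕ} {j : ℤ} (hj : j ∈ Finset.Icc (-m : ℤ) m) :
    thetaCoeff p m j = (∏ k ∈ Finset.range (2 * m), (1 - p * p ^ k)) *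
      ((∏ k ∈ Finset.range (m + j).toNat, (1 - p * p ^ k))⁻¹ *
        (∏ k ∈ Finset.range (m - j).toNat, (1 - p * p ^ k))⁻¹) := by
  have h0 : ∀ N, ∏ k ∈ Finset.range N, (1 - p * p ^ k) ≠ 0 := fun N =>
    Finset.prod_ne_zero_iff.2 fun k _ => one_sub_mul_pow_ne_zero hp k
  have h := gaussBinom_mul p (m + j).toNat (m - j).toNat
  rw [show (m + j).toNat + (m - j).toNat = 2 * m by simp at hj; omega] at h
  rw [thetaCoeff, if_pos hj, ← mul_inv, eq_mul_inv_iff_mul_eq₀ (mul_ne_zero (h0 _) (h0 _)), h]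

/-- In the factorial quotient the numerator and both denominator products tend to `(p; p)_∞`, which
leaves one inverse. -/
theorem tendsto_thetaCoeff {p : ℂ} (hp : ‖p‖ < 1) (j : ℤ) :
    Tendsto (fun m => thetaCoeff p m j) atTop (𝓝 (shiftedFactInf p p)⁻¹) := by
  have hne := shiftedFactInf_self_ne_zero hp
  have hT := tendsto_prod_shiftedFactInf hp p
  have h1 : Tendsto (fun m : ℕ => 2 * m) atTop atTop :=
    tendsto_atTop_mono (fun m => by simp; omega) tendsto_id
  have h2 : Tendsto (fun m : ℕ => (m + j).toNat) atTop atTop := by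
    refine tendsto_atTop.2 fun b => ?_
    filter_upwards [eventually_ge_atTop (b + j.natAbs)] with m hm
    omega
  have h3 : Tendsto (fun m : ℕ => (m - j).toNat) atTop atTop := by
    refine tendsto_atTop.2 fun b => ?_
    filter_upwards [eventually_ge_atTop (b + j.natAbs)] with m hm
    omega
  have := (hT.comp h1).mul (((hT.comp h2).inv₀ hne).mul ((hT.comp h3).inv₀ hne))
  rw [show shiftedFactInf p p * ((shiftedFactInf p p)⁻¹ * (shiftedFactInf p p)⁻¹) =
    (shiftedFactInf p p)⁻¹ by field_simp] at this
  refine this.congr' ?_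
  filter_upwards [eventually_ge_atTop j.natAbs] with m hm
  rw [thetaCoeff_eq hp (by simp; omega)]
  rfl

/-- The bound for dominated convergence: the partial products of `(p; p)_∞` and their inverses both
converge, hence are bounded. -/
theorem exists_norm_thetaCoeff_le {p : ℂ} (hp : ‖p‖ < 1) :
    ∃ C, ∀ m j, ‖thetaCoeff p m j‖ ≤ C := by
  have hT := tendsto_prod_shiftedFactInf hp p
  obtain ⟨C, hC⟩ := (Metric.isBounded_range_of_tendsto _ hT).exists_norm_le
  obtain ⟨D, hD⟩ := (Metric.isBounded_range_of_tendsto _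
    (hT.inv₀ (shiftedFactInf_self_ne_zero hp))).exists_norm_le
  have hC' : ∀ N, ‖∏ k ∈ Finset.range N, (1 - p * p ^ k)‖ ≤ C := fun N => hC _ ⟨N, rfl⟩
  have hD' : ∀ N, ‖(∏ k ∈ Finset.range N, (1 - p * p ^ k))⁻¹‖ ≤ D := fun N => hD _ ⟨N, rfl⟩
  have hC0 : 0 ≤ C := (norm_nonneg _).trans (hC' 0)
  have hD0 : 0 ≤ D := (norm_nonneg _).trans (hD' 0)
  refine ⟨C * (D * D), fun m j => ?_⟩
  by_cases hj : j ∈ Finset.Icc (-m : ℤ) m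
  · rw [thetaCoeff_eq hp hj, norm_mul, norm_mul]
    gcongr
    exacts [hC' _, hD' _, hD' _]
  · rw [thetaCoeff, if_neg hj, norm_zero]
    positivity

/-- The Jacobi triple product identity. -/
theorem ellE_eq_tsum {p x : ℂ} (hp0 : p ≠ 0) (hp : ‖p‖ < 1) (hx : x ≠ 0) :
    ellE x p = (∑' j : ℤ, thetaTerm p (-x) j) * (shiftedFactInf p p)⁻¹ := by
  obtain ⟨C, hC⟩ := exists_norm_thetaCoeff_le hp
  have hs := summable_norm_thetaTerm hp0 hp (neg_ne_zero.2 hx)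
  have h1 := tendsto_tsum_of_dominated_convergence (𝓕 := atTop)
    (f := fun (m : ℕ) j => thetaTerm p (-x) j * thetaCoeff p m j)
    (g := fun j => thetaTerm p (-x) j * (shiftedFactInf p p)⁻¹)
    (hs.mul_right C) (fun j => (tendsto_thetaCoeff hp j).const_mul _)
    (Eventually.of_forall fun m j => by
      rw [norm_mul]
      exact mul_le_mul_of_nonneg_left (hC m j) (norm_nonneg _))
  have h2 := (tendsto_prod_shiftedFactInf hp x).mul (tendsto_prod_shiftedFactInf hp (p / x))
  rw [← tsum_mul_right]
  refine tendsto_nhds_unique (h2.congr fun m => ?_) h1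
  exact prod_mul_prod_eq_tsum hp0 hx m

/-! ### The rank-two property and the addition formula -/

theorem thetaTerm_mul_thetaTerm {p x y : ℂ} (hp0 : p ≠ 0) (hx : x ≠ 0) (hy : y ≠ 0) (a b : ℤ) :
    thetaTerm p (-(x * y)) a * thetaTerm p (-(x / y)) b =
      (-1) ^ (a + b) * p ^ (tri a + tri b) * x ^ (a + b) * y ^ (a - b) := by
  rw [thetaTerm, thetaTerm, ← neg_one_mul, ← neg_one_mul (x / y), mul_zpow, mul_zpow, mul_zpow, div_zpow,
    zpow_add₀ (neg_ne_zero.2 one_ne_zero), zpow_add₀ hp0, zpow_add₀ hx, zpow_sub₀ hy]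
  ring

theorem thetaTerm_sq {p x : ℂ} (hp0 : p ≠ 0) (k : ℕ) (i : ℤ) :
    thetaTerm (p ^ 2) (p ^ k * x ^ 2) i = p ^ (2 * tri i + k * i) * x ^ (2 * i) := by
  rw [thetaTerm, mul_zpow, ← zpow_natCast p 2, ← zpow_mul, ← zpow_natCast p k, ← zpow_mul, ← zpow_natCast x 2,
    ← zpow_mul, zpow_add₀ hp0]
  push_cast
  ring

/-- Splitting the double series by the parity of the sum of its indices and passing to half-sum and
half-difference separates `x` from `y`, with nome `p ^ 2`. -/
theorem tsum_thetaTerm_mul {p x y : ℂ} (hp0 : p ≠ 0) (hp : ‖p‖ < 1) (hx : x ≠ 0) (hy : y ≠ 0) :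
    (∑' j : ℤ, thetaTerm p (-(x * y)) j) * (∑' j : ℤ, thetaTerm p (-(x / y)) j) =
      x * ((x * ∑' j : ℤ, thetaTerm (p ^ 2) (p ^ 2 * x ^ 2) j) *
          (∑' j : ℤ, thetaTerm (p ^ 2) (p ^ 1 * y ^ 2) j) -
        (∑' j : ℤ, thetaTerm (p ^ 2) (p ^ 1 * x ^ 2) j) *
          (y * ∑' j : ℤ, thetaTerm (p ^ 2) (p ^ 2 * y ^ 2) j)) := by
  have hs : ∀ z : ℂ, z ≠ 0 → Summable fun j => ‖thetaTerm p z j‖ := fun z hz =>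
    summable_norm_thetaTerm hp0 hp hz
  have hs2 : ∀ (k : ℕ) (z : ℂ), z ≠ 0 → Summable fun j => ‖thetaTerm (p ^ 2) (p ^ k * z ^ 2) j‖ :=
    fun k z hz => summable_norm_thetaTerm (pow_ne_zero 2 hp0) (norm_sq_lt_one_of_norm_lt_one hp)
      (mul_ne_zero (pow_ne_zero k hp0) (pow_ne_zero 2 hz))
  have hxy := hs _ (neg_ne_zero.2 (mul_ne_zero hx hy))
  have hxy' := hs _ (neg_ne_zero.2 (div_ne_zero hx hy))
  rw [tsum_mul_tsum_of_summable_norm hxy hxy']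
  -- `g₀` enumerates the index pairs with even sum and `g₁` those with odd sum; the shifts by one
  -- make all four resulting series instances of `thetaTerm (p ^ 2)`.
  let g₀ : ℤ × ℤ → ℤ × ℤ := fun z => (z.1 + 1 + z.2, z.1 + 1 - z.2)
  let g₁ : ℤ × ℤ → ℤ × ℤ := fun z => (z.1 + z.2 + 1, z.1 - z.2)
  have hg₀ : Function.Injective g₀ := by
    rintro ⟨a, b⟩ ⟨c, d⟩ h
    simp only [g₀, Prod.mk.injEq] at h ⊢
    omega
  have hg₁ : Function.Injective g₁ := by
    rintro ⟨a, b⟩ ⟨c, d⟩ h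
    simp only [g₁, Prod.mk.injEq] at h ⊢
    omega
  have hcompl : IsCompl (Set.range g₀) (Set.range g₁) := by
    constructor
    · rw [Set.disjoint_left]
      rintro _ ⟨⟨a, b⟩, rfl⟩ ⟨⟨c, d⟩, h⟩
      simp only [g₀, g₁, Prod.mk.injEq] at h
      omega
    · rw [codisjoint_iff_le_sup]
      rintro ⟨a, b⟩ -
      rcases Int.emod_two_eq_zero_or_one (a + b) with h | h
      · exact Or.inl ⟨((a + b) / 2 - 1, (a - b) / 2), by simp only [g₀, Prod.mk.injEq]; omega⟩
      · exact Or.inr ⟨((a + b - 1) / 2, (a - b - 1) / 2), by simp only [g₁, Prod.mk.injEq]; omega⟩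
  let f : ℤ × ℤ → ℂ := fun z => thetaTerm p (-(x * y)) z.1 * thetaTerm p (-(x / y)) z.2
  have e₀ : HasSum (f ∘ g₀) (x * x * ((∑' j : ℤ, thetaTerm (p ^ 2) (p ^ 2 * x ^ 2) j) *
      ∑' j : ℤ, thetaTerm (p ^ 2) (p ^ 1 * y ^ 2) j)) := by
    rw [tsum_mul_tsum_of_summable_norm (hs2 2 x hx) (hs2 1 y hy)]
    refine ((summable_mul_of_summable_norm (hs2 2 x hx) (hs2 1 y hy)).hasSum.mul_left _).congr_fun ?_
    rintro ⟨i, j⟩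
    simp only [f, g₀, Function.comp_apply]
    rw [thetaTerm_mul_thetaTerm hp0 hx hy, thetaTerm_sq hp0, thetaTerm_sq hp0]
    have h1 := two_mul_tri i
    have h2 := two_mul_tri j
    have h3 := two_mul_tri (i + 1 + j)
    have h4 := two_mul_tri (i + 1 - j)
    rw [show tri (i + 1 + j) + tri (i + 1 - j) = (2 * tri i + (2 : ℕ) * i) + (2 * tri j + (1 : ℕ) * j) by
      push_cast; linarith, show i + 1 + j + (i + 1 - j) = 2 * i + 1 + 1 by ring,
      show i + 1 + j - (i + 1 - j) = 2 * j by ring, zpow_add₀ hp0 (2 * tri i + (2 : ℕ) * i),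
      zpow_add_one₀ hx, zpow_add_one₀ hx, Even.neg_one_zpow ⟨i + 1, by ring⟩]
    ring
  have e₁ : HasSum (f ∘ g₁) (-(x * y) * ((∑' j : ℤ, thetaTerm (p ^ 2) (p ^ 1 * x ^ 2) j) *
      ∑' j : ℤ, thetaTerm (p ^ 2) (p ^ 2 * y ^ 2) j)) := by
    rw [tsum_mul_tsum_of_summable_norm (hs2 1 x hx) (hs2 2 y hy)]
    refine ((summable_mul_of_summable_norm (hs2 1 x hx) (hs2 2 y hy)).hasSum.mul_left _).congr_fun ?_
    rintro ⟨i, j⟩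
    simp only [f, g₁, Function.comp_apply]
    rw [thetaTerm_mul_thetaTerm hp0 hx hy, thetaTerm_sq hp0, thetaTerm_sq hp0]
    have h1 := two_mul_tri i
    have h2 := two_mul_tri j
    have h3 := two_mul_tri (i + j + 1)
    have h4 := two_mul_tri (i - j)
    rw [show tri (i + j + 1) + tri (i - j) = (2 * tri i + (1 : ℕ) * i) + (2 * tri j + (2 : ℕ) * j) by
      push_cast; linarith, show i + j + 1 + (i - j) = 2 * i + 1 by ring,
      show i + j + 1 - (i - j) = 2 * j + 1 by ring, zpow_add₀ hp0 (2 * tri i + (1 : ℕ) * i),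
      zpow_add_one₀ hx, zpow_add_one₀ hy, Odd.neg_one_zpow ⟨i, by ring⟩]
    ring
  rw [(HasSum.add_isCompl (f := f) hcompl (hg₀.hasSum_range_iff.2 e₀) (hg₁.hasSum_range_iff.2 e₁)).tsum_eq]
  ring

/-- As a function of `x` and `y`, the product `E(xy) E(x/y)` has rank two. -/
theorem exists_ellE_mul_ellE_div {p : ℂ} (hp : ‖p‖ < 1) : ∃ A B : ℂ → ℂ, ∀ x y, x ≠ 0 → y ≠ 0 →
    ellE (x * y) p * ellE (x / y) p = x * (A x * B y - B x * A y) := by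
  by_cases hp0 : p = 0
  · subst hp0
    -- The theta series involves negative powers of `p`, so `p = 0` is treated by hand: `E(x) = 1 -
    -- x`.
    refine ⟨fun x => x + x⁻¹, fun _ => 1, fun x y hx hy => ?_⟩
    simp only [ellE_zero_right]
    field_simp
    ring
  · refine ⟨fun x => (shiftedFactInf p p)⁻¹ ^ 2 * (x * ∑' j : ℤ, thetaTerm (p ^ 2) (p ^ 2 * x ^ 2) j),
      fun x => ∑' j : ℤ, thetaTerm (p ^ 2) (p ^ 1 * x ^ 2) j, fun x y hx hy => ?_⟩
    rw [ellE_eq_tsum hp0 hp (mul_ne_zero hx hy), ellE_eq_tsum hp0 hp (div_ne_zero hx hy)]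
    linear_combination ((shiftedFactInf p p)⁻¹ ^ 2) * tsum_thetaTerm_mul hp0 hp hx hy

/-- The addition formula (Weierstrass' three-term relation) for `E`. -/
theorem ellE_addition {p x y u v : ℂ} (hp : ‖p‖ < 1) (hx : x ≠ 0) (hy : y ≠ 0) (hu : u ≠ 0) (hv : v ≠ 0) :
    ellE (x * y) p * ellE (x / y) p * (ellE (u * v) p * ellE (u / v) p) -
      ellE (x * v) p * ellE (x / v) p * (ellE (u * y) p * ellE (u / y) p) =
      u / y * (ellE (y * v) p * ellE (y / v) p * (ellE (x * u) p * ellE (x / u) p)) := by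
  obtain ⟨A, B, h⟩ := exists_ellE_mul_ellE_div hp
  rw [h x y hx hy, h u v hu hv, h x v hx hv, h u y hu hy, h y v hy hv, h x u hx hu]
  field_simp
  ring

/-! ### Interpolation of symmetric theta functions -/

section HomogeneousForms

variable {X : Type*}

/-- Homogeneous polynomials of degree `n` in two functions `u` and `v`. -/
def homogForms (u v : X → ℂ) (n : ℕ) : Submodule ℂ (X → ℂ) :=
  Submodule.span ℂ (Set.range fun i : Fin (n + 1) => u ^ (i : ℕ) * v ^ (i.rev : ℕ))

theorem linear_mul_mem_homogForms {u v : X → ℂ} {n : ℕ} {F : X → ℂ} (hF : F ∈ homogForms u v n) (α β : ℂ) :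
    (α • u + β • v) * F ∈ homogForms u v (n + 1) := by
  induction hF using Submodule.span_induction with
  | mem F hF =>
    obtain ⟨i, rfl⟩ := hF
    rw [add_mul, smul_mul_assoc, smul_mul_assoc]
    refine Submodule.add_mem _ (Submodule.smul_mem _ _ (Submodule.subset_span ⟨i.succ, ?_⟩))
      (Submodule.smul_mem _ _ (Submodule.subset_span ⟨i.castSucc, ?_⟩))
    · have : (i.succ.rev : ℕ) = i.rev := by simp [Fin.val_rev]
      simp only [this, Fin.val_succ]
      ring
    · have : (i.castSucc.rev : ℕ) = i.rev + 1 := by simp [Fin.val_rev]; omega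
      simp only [this, Fin.val_castSucc]
      ring
  | zero => simp
  | add F G _ _ hF hG => rw [mul_add]; exact Submodule.add_mem _ hF hG
  | smul c F _ hF => rw [mul_smul_comm]; exact Submodule.smul_mem _ _ hF

theorem prod_linear_mem_homogForms (u v : X → ℂ) (n : ℕ) (α β : ℕ → ℂ) :
    ∏ j ∈ Finset.range n, (α j • u + β j • v) ∈ homogForms u v n := by
  induction n with
  | zero => exact Submodule.subset_span ⟨0, by simp⟩
  | succ n ih =>
    rw [Finset.prod_range_succ, mul_comm]
    exact linear_mul_mem_homogForms ih _ _

/-- The values at the points are the coefficients multiplied by a projective Vandermonde matrix,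
whose determinant is the product of the minors assumed nonzero. -/
theorem eq_zero_of_mem_homogForms {u v : X → ℂ} {n : ℕ} {F : X → ℂ} (hF : F ∈ homogForms u v n)
    (pt : Fin (n + 1) → X) (hpt : ∀ i j, i < j → u (pt j) * v (pt i) - u (pt i) * v (pt j) ≠ 0)
    (h0 : ∀ i, F (pt i) = 0) : F = 0 := by
  obtain ⟨c, rfl⟩ := (Submodule.mem_span_range_iff_exists_fun ℂ).1 hF
  have hdet : (Matrix.projVandermonde (u ∘ pt) (v ∘ pt)).det ≠ 0 := by
    rw [Matrix.det_projVandermonde]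
    exact Finset.prod_ne_zero_iff.2 fun i _ => Finset.prod_ne_zero_iff.2 fun j hj =>
      hpt i j (Finset.mem_Ioi.1 hj)
  have hc : c = 0 := by
    refine Matrix.eq_zero_of_mulVec_eq_zero hdet (funext fun i => ?_)
    rw [Pi.zero_apply, ← h0 i]
    simp only [Matrix.mulVec, dotProduct, Matrix.projVandermonde_apply, Finset.sum_apply, Pi.smul_apply,
      Pi.mul_apply, Pi.pow_apply, smul_eq_mul, Function.comp_apply]
    exact Finset.sum_congr rfl fun j _ => mul_comm _ _
  simp [hc]

end HomogeneousForms

/-- Theta functions of degree `n` in `d` that are symmetric under `d ↦ l / d`. -/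
def thetaForms (p l : ℂ) (n : ℕ) : Submodule ℂ (ℂ → ℂ) :=
  Submodule.span ℂ {F | ∃ x : ℕ → ℂ, (∀ j, x j ≠ 0) ∧
    F = fun d => ∏ j ∈ Finset.range n, (ellE (d * x j) p * ellE (x j * l / d) p)}

/-- By the rank-two property each factor `E(dx) E(xl/d)` is linear in two fixed functions of `d`.
The same identity turns the hypothesis on the points into nonvanishing of the Vandermonde minors. -/
theorem eq_zero_of_mem_thetaForms {p l : ℂ} (hp : ‖p‖ < 1) (hl : l ≠ 0) {n : ℕ} {F : ℂ → ℂ}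
    (hF : F ∈ thetaForms p l n) (pt : Fin (n + 1) → ℂ) (hpt0 : ∀ i, pt i ≠ 0)
    (hpt : ∀ i j, i < j → ellE (pt i * pt j / l) p ≠ 0 ∧ ellE (pt j / pt i) p ≠ 0)
    (h0 : ∀ i, F (pt i) = 0) {d : ℂ} (hd : d ≠ 0) : F d = 0 := by
  obtain ⟨A, B, hAB⟩ := exists_ellE_mul_ellE_div hp
  -- In the variable `d / r` the symmetry `d ↦ l / d` becomes inversion.
  obtain ⟨r, rfl⟩ : ∃ r, r ^ 2 = l := IsAlgClosed.exists_pow_nat_eq l two_pos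
  have hr : r ≠ 0 := fun h => hl (by simp [h])
  let u : {d : ℂ // d ≠ 0} → ℂ := fun d => A (d / r)
  let v : {d : ℂ // d ≠ 0} → ℂ := fun d => B (d / r)
  have hle : thetaForms p (r ^ 2) n ≤ (homogForms u v n).comap
      (LinearMap.funLeft ℂ ℂ (Subtype.val : {d : ℂ // d ≠ 0} → ℂ)) := by
    refine Submodule.span_le.2 ?_
    rintro _ ⟨x, hx, rfl⟩
    have := prod_linear_mem_homogForms u v n (fun j => -(r * x j * B (r * x j)))
      (fun j => r * x j * A (r * x j))
    simp only [Submodule.comap_coe, Set.mem_preimage, SetLike.mem_coe]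
    convert! this using 1
    ext ⟨d, hd⟩
    simp only [LinearMap.funLeft_apply, Finset.prod_apply, Pi.add_apply, Pi.smul_apply, smul_eq_mul, u, v]
    refine Finset.prod_congr rfl fun j _ => ?_
    have := hAB (r * x j) (d / r) (mul_ne_zero hr (hx j)) (div_ne_zero hd hr)
    rw [show r * x j * (d / r) = d * x j by field_simp,
      show r * x j / (d / r) = x j * r ^ 2 / d by field_simp] at this
    rw [this]
    ring
  have := eq_zero_of_mem_homogForms (hle hF) (fun i => ⟨pt i, hpt0 i⟩) (fun i j hij h => ?_) (fun i => h0 i)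
  · exact congrFun this ⟨d, hd⟩
  · have h2 := hAB (pt j / r) (pt i / r) (div_ne_zero (hpt0 j) hr) (div_ne_zero (hpt0 i) hr)
    rw [show pt j / r * (pt i / r) = pt i * pt j / r ^ 2 by field_simp,
      show pt j / r / (pt i / r) = pt j / pt i by field_simp] at h2
    refine mul_ne_zero (hpt i j hij).1 (hpt i j hij).2 ?_
    rw [h2]
    simp only [u, v] at h
    linear_combination (pt j / r) * h

theorem ellFact_mul_mem_thetaForms {p l x y s t : ℂ} (hx : x ≠ 0) (hy : y ≠ 0) (hs : s ≠ 0) (ht : t ≠ 0)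
    {k m n : ℕ} (hn : k + m = n) (c : ℂ) :
    (fun d => c * ((ellFact (d * x) s p k * ellFact (x * l / d) s p k) *
      (ellFact (d * y) t p m * ellFact (y * l / d) t p m))) ∈ thetaForms p l n := by
  refine Submodule.smul_mem _ c (Submodule.subset_span
    ⟨fun j => if j < k then x * s ^ j else y * t ^ (j - k), fun j => ?_, ?_⟩)
  · dsimp only
    split_ifs
    exacts [mul_ne_zero hx (pow_ne_zero _ hs), mul_ne_zero hy (pow_ne_zero _ ht)]
  · ext d
    rw [← hn, Finset.prod_range_add]
    simp only [ellFact, ← Finset.prod_mul_distrib]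
    congr 1
    · refine Finset.prod_congr rfl fun j hj => ?_
      rw [if_pos (Finset.mem_range.1 hj)]
      ring_nf
    · refine Finset.prod_congr rfl fun j hj => ?_
      rw [if_neg (by omega), Nat.add_sub_cancel_left]
      ring_nf

/-! ### Elliptic shifted factorials and the telescoping bibasic sum -/

theorem ellE_inv_ne_zero {p x : ℂ} (hp : ‖p‖ < 1) (hx : x ≠ 0) (h : ellE x p ≠ 0) : ellE x⁻¹ p ≠ 0 := by
  rw [ellE_inv hp hx]
  exact mul_ne_zero (neg_ne_zero.2 (inv_ne_zero hx)) h

theorem ellFact_add (x s p : ℂ) (m k : ℕ) :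
    ellFact x s p (m + k) = ellFact x s p m * ellFact (x * s ^ m) s p k := by
  simp only [ellFact, Finset.prod_range_add, pow_add, mul_assoc]

theorem ellFact_succ (x s p : ℂ) (m : ℕ) : ellFact x s p (m + 1) = ellFact x s p m * ellE (x * s ^ m) p := by
  simp only [ellFact, Finset.prod_range_succ]

theorem ellFact_succ_left (x s p : ℂ) (m : ℕ) :
    ellFact x s p (m + 1) = ellE x p * ellFact (x * s) s p m := by
  rw [add_comm, ellFact_add]; simp [ellFact]

theorem ellFact_eq_zero {x s p : ℂ} (hp : ‖p‖ < 1) {m k : ℕ} (hk : k < m) (h : x * s ^ k = 1) :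
    ellFact x s p m = 0 :=
  Finset.prod_eq_zero (Finset.mem_range.2 hk) (by rw [h, ellE_one hp])

theorem ellFact_ne_zero_iff {x s p : ℂ} {m : ℕ} : ellFact x s p m ≠ 0 ↔ ∀ k < m, ellE (x * s ^ k) p ≠ 0 := by
  simp [ellFact, Finset.prod_ne_zero_iff]

theorem ellFact_reverse {x y s p : ℂ} (hp : ‖p‖ < 1) (hs : s ≠ 0) (hy : y ≠ 0) {m : ℕ}
    (h : x * y * s ^ m = s) :
    ellFact y s p m = (∏ k ∈ Finset.range m, (-(y * s ^ k))) * ellFact x s p m := by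
  unfold ellFact
  rw [← Finset.prod_range_reflect (fun k => ellE (x * s ^ k) p), ← Finset.prod_mul_distrib]
  refine Finset.prod_congr rfl fun k hk => ?_
  have hk := Finset.mem_range.1 hk
  have hys : y * s ^ k ≠ 0 := mul_ne_zero hy (pow_ne_zero _ hs)
  have : x * s ^ (m - 1 - k) = (y * s ^ k)⁻¹ := by
    have e : s ^ m = s ^ (m - 1 - k) * s ^ k * s := by
      rw [← pow_add, ← pow_succ]; congr 1; omega
    rw [e] at h
    refine eq_inv_of_mul_eq_one_left (mul_right_cancel₀ hs ?_)
    linear_combination h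
  rw [this, ellE_inv hp hys]
  field_simp

/-- The inductive step of the telescoping sum, with `Q = q^{N+1}`; it is a case of the addition
formula. -/
theorem bibasic_step {p a b c Q : ℂ} (hp : ‖p‖ < 1) (ha : a ≠ 0) (hb : b ≠ 0) (hc : c ≠ 0) (hQ : Q ≠ 0) :
    ellE Q p * ellE (a * Q / b) p * (ellE (a * Q ^ 2 / c) p * ellE (b * c * Q ^ 2) p) +
      ellE (a * Q ^ 3) p * ellE (b * Q) p * ellE c p * ellE (a / (b * c)) p * Q =
    ellE (a * Q ^ 2) p * ellE (b * Q ^ 2) p * (ellE (c * Q) p * ellE (a * Q / (b * c)) p) := by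
  -- The square root puts the twelve arguments in the form of products and quotients of four
  -- variables.
  obtain ⟨y, hy⟩ : ∃ y, y ^ 2 = a / b := IsAlgClosed.exists_pow_nat_eq _ two_pos
  have ha' : a = b * y ^ 2 := by rw [hy]; field_simp
  have hy0 : y ≠ 0 := fun h => ha (by rw [ha', h]; ring)
  have := ellE_addition hp (x := b * y * Q ^ 2) (y := y) (u := y * Q) (v := c / y)
    (mul_ne_zero (mul_ne_zero hb hy0) (pow_ne_zero 2 hQ)) hy0 (mul_ne_zero hy0 hQ) (div_ne_zero hc hy0)
  rw [show b * y * Q ^ 2 * y = a * Q ^ 2 by rw [ha']; ring, show b * y * Q ^ 2 / y = b * Q ^ 2 by field_simp,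
    show y * Q * (c / y) = c * Q by field_simp, show y * Q / (c / y) = a * Q / (b * c) by rw [ha']; field_simp,
    show b * y * Q ^ 2 * (c / y) = b * c * Q ^ 2 by field_simp,
    show b * y * Q ^ 2 / (c / y) = a * Q ^ 2 / c by rw [ha']; field_simp,
    show y * Q * y = a * Q / b by rw [ha']; field_simp, show y * Q / y = Q by field_simp,
    show y * (c / y) = c by field_simp, show y / (c / y) = a / (b * c) by rw [ha']; field_simp,
    show b * y * Q ^ 2 * (y * Q) = a * Q ^ 3 by rw [ha']; ring,
    show b * y * Q ^ 2 / (y * Q) = b * Q by field_simp] at this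
  linear_combination -this

/-- The indefinite bibasic sum: a telescoping very-well-poised series. -/
theorem sum_bibasic {p a b c q : ℂ} (hp : ‖p‖ < 1) (ha : a ≠ 0) (hb : b ≠ 0) (hc : c ≠ 0) (hq : q ≠ 0)
    (hEa : ellE a p ≠ 0) (hEb : ellE b p ≠ 0) (N : ℕ)
    (h1 : ∀ k < N, ellE (q * q ^ k) p ≠ 0) (h2 : ∀ k < N, ellE (a * q / b * q ^ k) p ≠ 0)
    (h3 : ∀ k < N, ellE (a * q ^ 2 / c * (q ^ 2) ^ k) p ≠ 0)
    (h4 : ∀ k < N, ellE (b * c * q ^ 2 * (q ^ 2) ^ k) p ≠ 0) :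
    ∑ k ∈ Finset.range (N + 1), ellE (a * q ^ (3 * k)) p * ellE (b * q ^ k) p *
        (ellFact a (q ^ 2) p k * ellFact b (q ^ 2) p k * (ellFact c q p k * ellFact (a / (b * c)) q p k)) * q ^ k /
        (ellE a p * ellE b p * (ellFact q q p k * ellFact (a * q / b) q p k *
          (ellFact (a * q ^ 2 / c) (q ^ 2) p k * ellFact (b * c * q ^ 2) (q ^ 2) p k))) =
      (ellFact (a * q ^ 2) (q ^ 2) p N * ellFact (b * q ^ 2) (q ^ 2) p N *
        (ellFact (c * q) q p N * ellFact (a / (b * c) * q) q p N)) /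
        (ellFact q q p N * ellFact (a * q / b) q p N *
          (ellFact (a * q ^ 2 / c) (q ^ 2) p N * ellFact (b * c * q ^ 2) (q ^ 2) p N)) := by
  induction N with
  | zero => simp [ellFact, div_self, hEa, hEb]
  | succ N ih =>
    rw [Finset.sum_range_succ, ih (fun k hk => h1 k (by omega)) (fun k hk => h2 k (by omega))
      (fun k hk => h3 k (by omega)) (fun k hk => h4 k (by omega))]
    have key := bibasic_step hp ha hb hc (pow_ne_zero (N + 1) hq)
    have n1 := ellFact_ne_zero_iff.2 fun k hk => h1 k (Nat.lt_succ_of_lt hk)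
    have n2 := ellFact_ne_zero_iff.2 fun k hk => h2 k (Nat.lt_succ_of_lt hk)
    have n3 := ellFact_ne_zero_iff.2 fun k hk => h3 k (Nat.lt_succ_of_lt hk)
    have n4 := ellFact_ne_zero_iff.2 fun k hk => h4 k (Nat.lt_succ_of_lt hk)
    have m1 := h1 N N.lt_succ_self
    have m2 := h2 N N.lt_succ_self
    have m3 := h3 N N.lt_succ_self
    have m4 := h4 N N.lt_succ_self
    rw [ellFact_succ_left a, ellFact_succ_left b, ellFact_succ_left c, ellFact_succ_left (a / (b * c)),
      ellFact_succ q, ellFact_succ (a * q / b), ellFact_succ (a * q ^ 2 / c), ellFact_succ (b * c * q ^ 2),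
      ellFact_succ (a * q ^ 2), ellFact_succ (b * q ^ 2), ellFact_succ (c * q), ellFact_succ (a / (b * c) * q)]
    rw [show q ^ (N + 1) = q * q ^ N by ring, show a * (q * q ^ N) / b = a * q / b * q ^ N by ring,
      show a * (q * q ^ N) ^ 2 / c = a * q ^ 2 / c * (q ^ 2) ^ N by ring,
      show b * c * (q * q ^ N) ^ 2 = b * c * q ^ 2 * (q ^ 2) ^ N by ring,
      show a * (q * q ^ N) ^ 2 = a * q ^ 2 * (q ^ 2) ^ N by ring,
      show b * (q * q ^ N) ^ 2 = b * q ^ 2 * (q ^ 2) ^ N by ring,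
      show c * (q * q ^ N) = c * q * q ^ N by ring,
      show a * (q * q ^ N) / (b * c) = a / (b * c) * q * q ^ N by ring,
      show a * (q * q ^ N) ^ 3 = a * q ^ (3 * (N + 1)) by ring] at key
    rw [show q ^ (N + 1) = q * q ^ N by ring]
    generalize ellFact q q p N = e1, ellFact (a * q / b) q p N = e2,
      ellFact (a * q ^ 2 / c) (q ^ 2) p N = e3, ellFact (b * c * q ^ 2) (q ^ 2) p N = e4,
      ellE (q * q ^ N) p = f1, ellE (a * q / b * q ^ N) p = f2,
      ellE (a * q ^ 2 / c * (q ^ 2) ^ N) p = f3, ellE (b * c * q ^ 2 * (q ^ 2) ^ N) p = f4 at *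
    rw [div_add_div _ _ (by simp [*]) (by simp [*]), div_eq_div_iff (by simp [*]) (by simp [*])]
    generalize ellFact (a * q ^ 2) (q ^ 2) p N = g1, ellFact (b * q ^ 2) (q ^ 2) p N = g2,
      ellFact (c * q) q p N = g3, ellFact (a / (b * c) * q) q p N = g4 
    linear_combination (e1 * e2 * e3 * e4 * e1 * e2 * e3 * e4 * f1 * f2 * f3 * f4 * g1 * g2 * g3 * g4 * ellE a p * ellE b p) * key

/-! ### The quadratic sum as a function of `d` -/

/-- Generic parameters: no theta factor in the quadratic sum vanishes for a trivial reason. -/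
structure IsGeneric (a b q p : ℂ) : Prop where
  q_ne : q ≠ 0
  a_ne : a ≠ 0
  b_ne : b ≠ 0
  ellE_zpow : ∀ k : ℤ, k ≠ 0 → ellE (q ^ k) p ≠ 0
  ellE_mul_zpow : ∀ k : ℤ, ellE (a * q ^ k) p ≠ 0
  ellE_mul_zpow' : ∀ k : ℤ, ellE (b * q ^ k) p ≠ 0
  ellE_div_mul_zpow : ∀ k : ℤ, ellE (b / a * q ^ k) p ≠ 0

/-- The part of the summand of the quadratic sum that does not depend on `d`. -/
noncomputable def quadCoeff (a b q p : ℂ) (n k : ℕ) : ℂ :=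
  ellE (a * q ^ (3 * k)) p / ellE a p *
    ((ellFact a (q ^ 2) p k * ellFact b (q ^ 2) p k * ellFact (a * q / b) (q ^ 2) p k) /
      (ellFact q q p k * ellFact (a * q / b) q p k * ellFact b q p k)) *
    (ellFact (q ^ n)⁻¹ q p k / ellFact (a * q ^ (n + 2)) (q ^ 2) p k) * q ^ k

/-- The quadratic sum with `c` and `e` eliminated. -/
noncomputable def quadSum (a b q p : ℂ) (n : ℕ) (d : ℂ) : ℂ :=
  ∑ k ∈ Finset.range (n + 1), quadCoeff a b q p n k *
    ((ellFact d q p k * ellFact (a * q ^ (n + 1) / d) q p k) /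
      (ellFact (d * (q / q ^ n)) (q ^ 2) p k * ellFact (a * q ^ 2 / d) (q ^ 2) p k))

/-- The denominator of `quadSum` as a function of `d`. -/
noncomputable def quadDenom (a q p : ℂ) (n : ℕ) (d : ℂ) : ℂ :=
  ellFact (d * (q / q ^ n)) (q ^ 2) p n * ellFact (a * q ^ 2 / d) (q ^ 2) p n

/-- The quadratic sum multiplied by `quadDenom`. -/
noncomputable def quadNumer (a b q p : ℂ) (n : ℕ) (d : ℂ) : ℂ :=
  ∑ k ∈ Finset.range (n + 1), quadCoeff a b q p n k *
    ((ellFact d q p k * ellFact (a * q ^ (n + 1) / d) q p k) *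
      (ellFact (d * (q / q ^ n * (q ^ 2) ^ k)) (q ^ 2) p (n - k) *
        ellFact (a * q ^ 2 / d * (q ^ 2) ^ k) (q ^ 2) p (n - k)))

/-- The value of the quadratic sum of length `2 m + 1`. -/
noncomputable def quadValue (a b q p : ℂ) (m : ℕ) (d : ℂ) : ℂ :=
  (ellFact (a * q ^ 2) (q ^ 2) p m * ellFact q (q ^ 2) p m * ellFact (a * q ^ 2 / (b * d)) (q ^ 2) p m *
      ellFact (b * q / d) (q ^ 2) p m) /
    (ellFact (a * q ^ 2 / b) (q ^ 2) p m * ellFact (b * q) (q ^ 2) p m * ellFact (a * q ^ 2 / d) (q ^ 2) p m *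
      ellFact (q / d) (q ^ 2) p m)

/-- `quadValue` multiplied by `quadDenom`. -/
noncomputable def quadValueNumer (a b q p : ℂ) (m : ℕ) (d : ℂ) : ℂ :=
  (ellFact (a * q ^ 2) (q ^ 2) p m * ellFact q (q ^ 2) p m) /
    (ellFact (a * q ^ 2 / b) (q ^ 2) p m * ellFact (b * q) (q ^ 2) p m) * b ^ m *
    ((ellFact (d * (q / q ^ (2 * m) / b)) (q ^ 2) p m * ellFact (a * q ^ 2 / (b * d)) (q ^ 2) p m) *
      (ellFact (d * q) (q ^ 2) p m * ellFact (a * q ^ 2 / d * (q ^ 2) ^ m) (q ^ 2) p m))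

section QuadraticSum

variable {a b d p q : ℂ}

theorem quadSum_mul_quadDenom {n : ℕ} (h : quadDenom a q p n d ≠ 0) :
    quadSum a b q p n d * quadDenom a q p n d = quadNumer a b q p n d := by
  rw [quadSum, quadNumer, Finset.sum_mul]
  refine Finset.sum_congr rfl fun k hk => ?_
  have hk : k + (n - k) = n := by have := Finset.mem_range.1 hk; omega
  rw [quadDenom, ← hk, ellFact_add, ellFact_add] at h
  have h1 := left_ne_zero_of_mul (left_ne_zero_of_mul h)
  have h2 := left_ne_zero_of_mul (right_ne_zero_of_mul h)
  rw [quadDenom]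
  conv_lhs => rw [← hk]
  rw [ellFact_add _ _ _ k (n - k), ellFact_add _ _ _ k (n - k), hk]
  rw [hk] at h1
  rw [← mul_assoc d]
  generalize ellFact (d * (q / q ^ n)) (q ^ 2) p k = u, ellFact (a * q ^ 2 / d) (q ^ 2) p k = v,
    ellFact (d * (q / q ^ n) * (q ^ 2) ^ k) (q ^ 2) p (n - k) = u',
    ellFact (a * q ^ 2 / d * (q ^ 2) ^ k) (q ^ 2) p (n - k) = v' at *
  field_simp

/-- Under `d ↦ a q^{n+1} / d` the factors pair off; the `k`-th term has `k` pairs in base `q` and `n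
- k` pairs in base `q ^ 2`. -/
theorem quadNumer_mem_thetaForms (ha : a ≠ 0) (hq : q ≠ 0) (n : ℕ) :
    (fun d => quadNumer a b q p n d) ∈ thetaForms p (a * q ^ (n + 1)) n := by
  have : (fun d => quadNumer a b q p n d) = ∑ k ∈ Finset.range (n + 1), fun d => quadCoeff a b q p n k *
    ((ellFact (d * 1) q p k * ellFact (1 * (a * q ^ (n + 1)) / d) q p k) *
      (ellFact (d * (q / q ^ n * (q ^ 2) ^ k)) (q ^ 2) p (n - k) *
        ellFact (q / q ^ n * (q ^ 2) ^ k * (a * q ^ (n + 1)) / d) (q ^ 2) p (n - k))) := by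
    ext d
    rw [Finset.sum_apply]
    refine Finset.sum_congr rfl fun k _ => ?_
    rw [mul_one, one_mul, show q / q ^ n * (q ^ 2) ^ k * (a * q ^ (n + 1)) / d = a * q ^ 2 / d * (q ^ 2) ^ k by
      field_simp; ring]
  rw [this]
  refine Submodule.sum_mem _ fun k hk => ellFact_mul_mem_thetaForms one_ne_zero
    (mul_ne_zero (div_ne_zero hq (pow_ne_zero _ hq)) (pow_ne_zero _ (pow_ne_zero _ hq))) hq
    (pow_ne_zero _ hq) ?_ _
  have := Finset.mem_range.1 hk
  omega

theorem quadValueNumer_mem_thetaForms (hb : b ≠ 0) (hq : q ≠ 0) (m : ℕ) :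
    (fun d => quadValueNumer a b q p m d) ∈ thetaForms p (a * q ^ (2 * m + 1)) (2 * m) := by
  have := ellFact_mul_mem_thetaForms (p := p) (l := a * q ^ (2 * m + 1)) (x := q / q ^ (2 * m) / b) (y := q)
    (s := q ^ 2) (t := q ^ 2) (div_ne_zero (div_ne_zero hq (pow_ne_zero _ hq)) hb) hq (pow_ne_zero _ hq)
    (pow_ne_zero _ hq) (two_mul m).symm ((ellFact (a * q ^ 2) (q ^ 2) p m * ellFact q (q ^ 2) p m) /
    (ellFact (a * q ^ 2 / b) (q ^ 2) p m * ellFact (b * q) (q ^ 2) p m) * b ^ m)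
  convert! this using 2 with d
  rw [quadValueNumer, show q / q ^ (2 * m) / b * (a * q ^ (2 * m + 1)) / d = a * q ^ 2 / (b * d) by
    field_simp; ring, show q * (a * q ^ (2 * m + 1)) / d = a * q ^ 2 / d * (q ^ 2) ^ m by ring]

/-- Dividing this by its case `b = 1` produces the factor `b ^ m` in `quadValueNumer`. -/
theorem ellFact_div_reverse (hp : ‖p‖ < 1) (hb : b ≠ 0) (hd : d ≠ 0) (hq : q ≠ 0) (m : ℕ) :
    ellFact (b * q / d) (q ^ 2) p m = b ^ m * (∏ k ∈ Finset.range m, (-(q / d * (q ^ 2) ^ k))) *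
      ellFact (d * (q / q ^ (2 * m) / b)) (q ^ 2) p m := by
  rw [ellFact_reverse (x := d * (q / q ^ (2 * m) / b)) hp (pow_ne_zero 2 hq)
    (div_ne_zero (mul_ne_zero hb hq) hd) (by rw [← pow_mul]; field_simp)]
  congr 1
  rw [← Finset.card_range m, ← Finset.prod_const, Finset.card_range, ← Finset.prod_mul_distrib]
  exact Finset.prod_congr rfl fun k _ => by ring

theorem quadValue_mul_quadDenom (hp : ‖p‖ < 1) (hb : b ≠ 0) (hd : d ≠ 0) (hq : q ≠ 0) {m : ℕ}
    (h : quadDenom a q p (2 * m) d ≠ 0) :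
    quadValue a b q p m d * quadDenom a q p (2 * m) d = quadValueNumer a b q p m d := by
  have e1 := ellFact_div_reverse (p := p) hp hb hd hq m
  have e2 := ellFact_div_reverse (p := p) hp one_ne_zero hd hq m
  rw [one_mul, one_pow, one_mul, div_one] at e2
  have hC : ∏ k ∈ Finset.range m, (-(q / d * (q ^ 2) ^ k)) ≠ 0 :=
    Finset.prod_ne_zero_iff.2 fun k _ => by simp [hq, hd]
  rw [quadDenom, two_mul m, ellFact_add, ellFact_add, ← two_mul m] at h ⊢
  have h1 := left_ne_zero_of_mul (left_ne_zero_of_mul h)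
  have h2 := left_ne_zero_of_mul (right_ne_zero_of_mul h)
  rw [quadValue, quadValueNumer, e1, e2,
    show d * (q / q ^ (2 * m)) * (q ^ 2) ^ m = d * q by rw [← pow_mul]; field_simp]
  generalize ∏ k ∈ Finset.range m, (-(q / d * (q ^ 2) ^ k)) = C, ellFact (d * (q / q ^ (2 * m))) (q ^ 2) p m = u,
    ellFact (a * q ^ 2 / d) (q ^ 2) p m = v, ellFact (d * (q / q ^ (2 * m) / b)) (q ^ 2) p m = w,
    ellFact (a * q ^ 2 / b) (q ^ 2) p m = x, ellFact (b * q) (q ^ 2) p m = y at *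
  field_simp

/-- The factor `(q^{-i}; q, p)_k` removes the terms with `k > i`, and the remaining summand is
symmetric in `i` and `n`. -/
theorem quadSum_swap (hp : ‖p‖ < 1) (hq : q ≠ 0) {i n : ℕ} (hi : i ≤ n) :
    quadSum a b q p n (q ^ i)⁻¹ = quadSum a b q p i (q ^ n)⁻¹ := by
  rw [quadSum, quadSum]
  symm
  refine Finset.sum_subset_zero_on_sdiff (by simpa using hi) (fun k hk => ?_) (fun k _ => ?_)
  · simp only [Finset.mem_sdiff, Finset.mem_range] at hk
    rw [ellFact_eq_zero (x := (q ^ i)⁻¹) hp (by omega : i < k) (inv_mul_cancel₀ (pow_ne_zero _ hq))]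
    simp
  · rw [quadCoeff, quadCoeff, show a * q ^ (n + 1) / (q ^ i)⁻¹ = a * q ^ (i + 1) / (q ^ n)⁻¹ by
      rw [div_inv_eq_mul, div_inv_eq_mul]; ring,
      show a * q ^ 2 / (q ^ n)⁻¹ = a * q ^ (n + 2) by rw [div_inv_eq_mul]; ring,
      show a * q ^ 2 / (q ^ i)⁻¹ = a * q ^ (i + 2) by rw [div_inv_eq_mul]; ring,
      show (q ^ i)⁻¹ * (q / q ^ n) = (q ^ n)⁻¹ * (q / q ^ i) by ring]
    ring

namespace IsGeneric

variable (h : IsGeneric a b q p)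
include h

theorem ellE_zpow_of_eq {x : ℂ} (k : ℤ) (hk : k ≠ 0) (hx : x = q ^ k) : ellE x p ≠ 0 :=
  hx ▸ h.ellE_zpow k hk

theorem ellE_a_of_eq {x : ℂ} (k : ℤ) (hx : x = a * q ^ k) : ellE x p ≠ 0 :=
  hx ▸ h.ellE_mul_zpow k

theorem ellE_b_of_eq {x : ℂ} (k : ℤ) (hx : x = b * q ^ k) : ellE x p ≠ 0 :=
  hx ▸ h.ellE_mul_zpow' k

theorem ellE_a_div_b_of_eq (hp : ‖p‖ < 1) {x : ℂ} (k : ℤ) (hx : x = a / b * q ^ k) : ellE x p ≠ 0 := by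
  have := ellE_inv_ne_zero hp (mul_ne_zero (div_ne_zero h.b_ne h.a_ne) (zpow_ne_zero _ h.q_ne))
    (h.ellE_div_mul_zpow (-k))
  rwa [mul_inv, inv_div, zpow_neg, inv_inv, ← hx] at this

end IsGeneric

/-- Cross-multiplied, both sides are the shifted factorial of length `l + m`. -/
theorem ellFact_div_swap {x s p : ℂ} {l m : ℕ} (h1 : ellFact (x * s ^ l) s p m ≠ 0)
    (h2 : ellFact (x * s ^ m) s p l ≠ 0) :
    ellFact x s p m / ellFact (x * s ^ l) s p m = ellFact x s p l / ellFact (x * s ^ m) s p l := by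
  rw [div_eq_div_iff h1 h2, ← ellFact_add, ← ellFact_add, add_comm]

/-! ### Evaluation at the interpolation points for generic parameters -/

namespace IsGeneric

variable (h : IsGeneric a b q p)
include h

theorem ellFact_a_ne_zero (l m : ℕ) : ellFact (a * q ^ 2 * (q ^ 2) ^ l) (q ^ 2) p m ≠ 0 :=
  ellFact_ne_zero_iff.2 fun k _ => h.ellE_a_of_eq ((2 + 2 * l + 2 * k : ℕ) : ℤ) (by rw [zpow_natCast]; ring)

theorem ellFact_b_ne_zero (l m : ℕ) : ellFact (b * q * (q ^ 2) ^ l) (q ^ 2) p m ≠ 0 :=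
  ellFact_ne_zero_iff.2 fun k _ => h.ellE_b_of_eq ((1 + 2 * l + 2 * k : ℕ) : ℤ) (by rw [zpow_natCast]; ring)

theorem ellFact_q_ne_zero (l m : ℕ) : ellFact (q * (q ^ 2) ^ l) (q ^ 2) p m ≠ 0 :=
  ellFact_ne_zero_iff.2 fun k _ => h.ellE_zpow_of_eq ((1 + 2 * l + 2 * k : ℕ) : ℤ) (by omega)
    (by rw [zpow_natCast]; ring)

theorem ellFact_a_div_b_ne_zero (hp : ‖p‖ < 1) (l m : ℕ) :
    ellFact (a * q ^ 2 / b * (q ^ 2) ^ l) (q ^ 2) p m ≠ 0 :=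
  ellFact_ne_zero_iff.2 fun k _ => h.ellE_a_div_b_of_eq hp ((2 + 2 * l + 2 * k : ℕ) : ℤ)
    (by rw [zpow_natCast]; ring)

/-- Evenness of `n + i` makes the exponents `1 + 2k - (n + i)` odd, hence nonzero. -/
theorem quadDenom_inv_pow_ne_zero {i n : ℕ} (hin : Even (n + i)) : quadDenom a q p n (q ^ i)⁻¹ ≠ 0 := by
  have hq := h.q_ne
  refine mul_ne_zero (ellFact_ne_zero_iff.2 fun k _ => ?_) (ellFact_ne_zero_iff.2 fun k _ => ?_)
  · refine h.ellE_zpow_of_eq (1 + (2 * k : ℕ) - (n + i : ℕ)) ?_ ?_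
    · obtain ⟨t, ht⟩ := hin
      omega
    · rw [zpow_sub₀ hq, zpow_add₀ hq, zpow_natCast, zpow_natCast, pow_mul, pow_add, zpow_one]
      field_simp
  · refine h.ellE_a_of_eq ((2 + i + 2 * k : ℕ) : ℤ) ?_
    rw [zpow_natCast, div_inv_eq_mul]
    ring

theorem quadDenom_mul_ne_zero (hp : ‖p‖ < 1) (n : ℕ) : quadDenom a q p n (b * q) ≠ 0 := by
  have hq := h.q_ne
  refine mul_ne_zero (ellFact_ne_zero_iff.2 fun k _ => ?_) (ellFact_ne_zero_iff.2 fun k _ => ?_)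
  · refine h.ellE_b_of_eq ((2 + 2 * k : ℕ) - (n : ℕ)) ?_
    rw [zpow_sub₀ hq, zpow_natCast, zpow_natCast, pow_add, pow_mul]
    field_simp
  · refine h.ellE_a_div_b_of_eq hp ((1 + 2 * k : ℕ) : ℤ) ?_
    rw [zpow_natCast, pow_add, pow_mul]
    field_simp

/-- At `d = bq` the factor `(aq/b; q², p)_k` cancels and `(bq; q, p)_k / (b; q, p)_k` reduces to
`E(b q^k) / E(b)`. This is the bibasic sum with `c = q^{-n}`, whose closed form contains `(q^{1-n};
q, p)_n = 0`. -/
theorem quadSum_mul_eq_zero (hp : ‖p‖ < 1) {n : ℕ} (hn : n ≠ 0) : quadSum a b q p n (b * q) = 0 := by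
  have hq := h.q_ne
  have ha := h.a_ne
  have hb := h.b_ne
  have hEa : ellE a p ≠ 0 := h.ellE_a_of_eq 0 (by simp)
  have hEb : ellE b p ≠ 0 := h.ellE_b_of_eq 0 (by simp)
  have key := sum_bibasic hp ha hb (inv_ne_zero (pow_ne_zero n hq)) hq hEa hEb n
    (fun k _ => h.ellE_zpow_of_eq ((k + 1 : ℕ) : ℤ) (by omega) (by rw [zpow_natCast]; ring))
    (fun k _ => h.ellE_a_div_b_of_eq hp ((k + 1 : ℕ) : ℤ) (by rw [zpow_natCast]; ring))
    (fun k _ => h.ellE_a_of_eq ((2 + n + 2 * k : ℕ) : ℤ) (by rw [zpow_natCast, div_inv_eq_mul]; ring))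
    (fun k _ => h.ellE_b_of_eq ((2 + 2 * k : ℕ) - (n : ℤ)) (by
      rw [zpow_sub₀ hq, zpow_natCast, zpow_natCast, pow_add, pow_mul]; field_simp))
  have hz : ellFact ((q ^ n)⁻¹ * q) q p n = 0 := by
    refine ellFact_eq_zero hp (by omega : n - 1 < n) ?_
    rw [mul_assoc, ← pow_succ', Nat.sub_add_cancel (Nat.pos_of_ne_zero hn),
      inv_mul_cancel₀ (pow_ne_zero _ hq)]
  rw [hz] at key
  simp only [zero_mul, mul_zero, zero_div] at key
  rw [← key, quadSum]
  refine Finset.sum_congr rfl fun k _ => ?_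
  have e1 : ellFact b q p k * ellE (b * q ^ k) p = ellE b p * ellFact (b * q) q p k := by
    rw [← ellFact_succ, ellFact_succ_left]
  have n1 : ellFact b q p k ≠ 0 := ellFact_ne_zero_iff.2 fun j _ => h.ellE_b_of_eq (j : ℤ) (by rw [zpow_natCast])
  have n2 : ellFact (a * q / b) (q ^ 2) p k ≠ 0 := ellFact_ne_zero_iff.2 fun j _ =>
    h.ellE_a_div_b_of_eq hp ((1 + 2 * j : ℕ) : ℤ) (by rw [zpow_natCast]; ring)
  rw [quadCoeff, show a * q ^ (n + 1) / (b * q) = a / (b * (q ^ n)⁻¹) by field_simp; ring,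
    show a * q ^ 2 / (b * q) = a * q / b by field_simp,
    show b * q * (q / q ^ n) = b * (q ^ n)⁻¹ * q ^ 2 by ring,
    show a * q ^ 2 / (q ^ n)⁻¹ = a * q ^ (n + 2) by rw [div_inv_eq_mul]; ring]
  have e2 : ellFact (b * q) q p k = ellFact b q p k * ellE (b * q ^ k) p / ellE b p := by
    rw [e1]; field_simp
  rw [e2]
  generalize ellFact b q p k = u, ellE b p = v, ellFact (a * q / b) (q ^ 2) p k = w at *
  field_simp

/-- For `k > i` the factor `(q^{-i}; q, p)_k` vanishes. For `k ≤ i`, with `n + i = 2t + 1`, the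
factor of index `t - k` in the complementary denominator is `E(1)`. -/
theorem quadNumer_inv_pow_eq_zero (hp : ‖p‖ < 1) {i n : ℕ} (hi : i < n) (hin : Odd (n + i)) :
    quadNumer a b q p n (q ^ i)⁻¹ = 0 := by
  have hq := h.q_ne
  refine Finset.sum_eq_zero fun k hk => ?_
  have hk := Finset.mem_range.1 hk
  obtain ⟨t, ht⟩ := hin
  rcases lt_or_ge i k with hik | hik
  · rw [ellFact_eq_zero (x := (q ^ i)⁻¹) hp hik (inv_mul_cancel₀ (pow_ne_zero _ hq))]
    simp
  · have : ellFact ((q ^ i)⁻¹ * (q / q ^ n * (q ^ 2) ^ k)) (q ^ 2) p (n - k) = 0 := by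
      refine ellFact_eq_zero hp (by omega : t - k < n - k) ?_
      have e : q * (q ^ 2) ^ k * (q ^ 2) ^ (t - k) = q ^ n * q ^ i := by
        rw [mul_assoc, ← pow_add, ← pow_mul, ← pow_succ', ← pow_add]
        congr 1
        omega
      field_simp
      linear_combination e
    rw [this]
    simp

theorem quadValueNumer_inv_pow_eq_zero (hp : ‖p‖ < 1) {l m : ℕ} (hl : l < m) :
    quadValueNumer a b q p m (q ^ (2 * l + 1))⁻¹ = 0 := by
  have hq := h.q_ne
  have : ellFact ((q ^ (2 * l + 1))⁻¹ * q) (q ^ 2) p m = 0 := by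
    refine ellFact_eq_zero hp hl ?_
    rw [← pow_mul]
    field_simp
    ring
  rw [quadValueNumer, this]
  simp

theorem quadValueNumer_mul_eq_zero (hp : ‖p‖ < 1) {m : ℕ} (hm : m ≠ 0) :
    quadValueNumer a b q p m (b * q) = 0 := by
  have hq := h.q_ne
  have hb := h.b_ne
  have : ellFact (b * q * (q / q ^ (2 * m) / b)) (q ^ 2) p m = 0 := by
    refine ellFact_eq_zero hp (by omega : m - 1 < m) ?_
    have e : q * q * (q ^ 2) ^ (m - 1) = q ^ (2 * m) := by
      rw [← pow_two, ← pow_succ', ← pow_mul]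
      congr 1
      omega
    field_simp
    linear_combination e
  rw [quadValueNumer, this]
  simp

/-- At `d = q^{-2t}` the value is a product of quotients `(x)_s / (x q^{2t})_s` and their inverses
in base `q ^ 2`, each symmetric in `s` and `t`. -/
theorem quadValue_swap (hp : ‖p‖ < 1) (l m : ℕ) :
    quadValue a b q p l (q ^ (2 * m))⁻¹ = quadValue a b q p m (q ^ (2 * l))⁻¹ := by
  have hq := h.q_ne
  have key : ∀ s t : ℕ, quadValue a b q p s (q ^ (2 * t))⁻¹ =
      (ellFact (a * q ^ 2) (q ^ 2) p s / ellFact (a * q ^ 2 * (q ^ 2) ^ t) (q ^ 2) p s) *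
      (ellFact q (q ^ 2) p s / ellFact (q * (q ^ 2) ^ t) (q ^ 2) p s) *
      (ellFact (a * q ^ 2 / b) (q ^ 2) p s / ellFact (a * q ^ 2 / b * (q ^ 2) ^ t) (q ^ 2) p s)⁻¹ *
      (ellFact (b * q) (q ^ 2) p s / ellFact (b * q * (q ^ 2) ^ t) (q ^ 2) p s)⁻¹ := fun s t => by
    rw [quadValue, ← div_div _ b, div_inv_eq_mul, div_inv_eq_mul, div_inv_eq_mul, div_inv_eq_mul, pow_mul,
      inv_div, inv_div]
    ring
  rw [key, key, ellFact_div_swap (h.ellFact_a_ne_zero m l) (h.ellFact_a_ne_zero l m),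
    ellFact_div_swap (h.ellFact_q_ne_zero m l) (h.ellFact_q_ne_zero l m),
    ellFact_div_swap (h.ellFact_a_div_b_ne_zero hp m l) (h.ellFact_a_div_b_ne_zero hp l m),
    ellFact_div_swap (h.ellFact_b_ne_zero m l) (h.ellFact_b_ne_zero l m)]

theorem quadNumer_eq (hp : ‖p‖ < 1) (n : ℕ) : ∀ d, d ≠ 0 →
    quadNumer a b q p n d = if Even n then quadValueNumer a b q p (n / 2) d else 0 := by
  induction n using Nat.strong_induction_on with
  | _ n ih =>
  intro d hd
  have hq := h.q_ne
  have ha := h.a_ne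
  have hb := h.b_ne
  rcases Nat.eq_zero_or_pos n with rfl | hn
  · have : ellE a p ≠ 0 := h.ellE_a_of_eq 0 (by simp)
    simp [quadNumer, quadValueNumer, quadCoeff, ellFact, this]
  set G : ℂ → ℂ := fun d => if Even n then quadValueNumer a b q p (n / 2) d else 0 with hG
  have hGmem : G ∈ thetaForms p (a * q ^ (n + 1)) n := by
    by_cases he : Even n
    · simp only [hG, if_pos he]
      have := quadValueNumer_mem_thetaForms (a := a) (p := p) hb hq (n / 2)
      rwa [Nat.two_mul_div_two_of_even he] at this
    · simp only [hG, if_neg he]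
      exact Submodule.zero_mem _
  refine sub_eq_zero.1 (eq_zero_of_mem_thetaForms hp (mul_ne_zero ha (pow_ne_zero (n + 1) hq))
    (Submodule.sub_mem _ (quadNumer_mem_thetaForms ha hq n) hGmem)
    -- The point `q^{-n}` is not used, since the swap there returns the same sum; `bq` takes its
    -- place.
    (fun i : Fin (n + 1) => if (i : ℕ) < n then (q ^ (i : ℕ))⁻¹ else b * q) (fun i => ?_) (fun i j hij => ?_)
    (fun i => ?_) hd)
  · split_ifs
    exacts [inv_ne_zero (pow_ne_zero _ hq), mul_ne_zero hb hq]
  · obtain ⟨i, hi⟩ := i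
    obtain ⟨j, hj⟩ := j
    simp only [Fin.mk_lt_mk] at hij
    dsimp only
    rw [if_pos (by omega : i < n)]
    split_ifs with hjn
    · constructor
      · rw [show (q ^ i)⁻¹ * (q ^ j)⁻¹ / (a * q ^ (n + 1)) = (a * q ^ ((n + 1 + i + j : ℕ) : ℤ))⁻¹ by
          rw [zpow_natCast, pow_add _ _ j, pow_add _ _ i]; field_simp]
        exact ellE_inv_ne_zero hp (mul_ne_zero ha (zpow_ne_zero _ hq)) (h.ellE_mul_zpow _)
      · refine h.ellE_zpow_of_eq ((i : ℤ) - j) (by omega) ?_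
        rw [zpow_sub₀ hq, zpow_natCast, zpow_natCast]
        field_simp
    · constructor
      · rw [show (q ^ i)⁻¹ * (b * q) / (a * q ^ (n + 1)) = b / a * q ^ (-(n + i : ℕ) : ℤ) by
          rw [zpow_neg, zpow_natCast, pow_add, pow_add]; field_simp]
        exact h.ellE_div_mul_zpow _
      · refine h.ellE_b_of_eq ((i + 1 : ℕ) : ℤ) ?_
        rw [zpow_natCast, div_inv_eq_mul]
        ring
  · obtain ⟨i, hi⟩ := i
    rw [Pi.sub_apply, sub_eq_zero]
    simp only [hG]
    by_cases hin : i < n <;> by_cases he : Even n <;> simp only [hin, he, if_true, if_false]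
    · obtain ⟨m, hm⟩ := he
      obtain rfl : n = 2 * m := by omega
      rw [Nat.mul_div_cancel_left m two_pos]
      rcases Nat.even_or_odd' i with ⟨l, rfl | rfl⟩
      · have e1 := ih (2 * l) hin (q ^ (2 * m))⁻¹ (inv_ne_zero (pow_ne_zero _ hq))
        rw [if_pos (even_two_mul l), Nat.mul_div_cancel_left l two_pos] at e1
        have d1 := h.quadDenom_inv_pow_ne_zero (i := 2 * m) (n := 2 * l) ⟨m + l, by ring⟩
        have d2 := h.quadDenom_inv_pow_ne_zero (i := 2 * l) (n := 2 * m) ⟨m + l, by ring⟩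
        rw [← quadSum_mul_quadDenom d1, ← quadValue_mul_quadDenom hp hb (inv_ne_zero (pow_ne_zero _ hq)) hq d1]
          at e1
        rw [← quadSum_mul_quadDenom d2, ← quadValue_mul_quadDenom hp hb (inv_ne_zero (pow_ne_zero _ hq)) hq d2,
          quadSum_swap hp hq hin.le, mul_right_cancel₀ d1 e1, h.quadValue_swap hp]
      · rw [h.quadNumer_inv_pow_eq_zero hp hin ⟨m + l, by ring⟩,
          h.quadValueNumer_inv_pow_eq_zero hp (by omega)]
    · rcases Nat.even_or_odd (n + i) with hni | hni
      · have e1 := ih i hin (q ^ n)⁻¹ (inv_ne_zero (pow_ne_zero _ hq))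
        rw [if_neg (fun hi => he ((Nat.even_add.1 hni).2 hi))] at e1
        have d1 := h.quadDenom_inv_pow_ne_zero (i := n) (n := i) (by rwa [add_comm])
        have d2 := h.quadDenom_inv_pow_ne_zero hni
        rw [← quadSum_mul_quadDenom d1] at e1
        rw [← quadSum_mul_quadDenom d2, quadSum_swap hp hq hin.le, (mul_eq_zero.1 e1).resolve_right d1, zero_mul]
      · exact h.quadNumer_inv_pow_eq_zero hp hin hni
    · obtain ⟨m, hm⟩ := he
      rw [h.quadValueNumer_mul_eq_zero hp (by omega), ← quadSum_mul_quadDenom (h.quadDenom_mul_ne_zero hp n),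
        h.quadSum_mul_eq_zero hp hn.ne', zero_mul]
    · rw [← quadSum_mul_quadDenom (h.quadDenom_mul_ne_zero hp n),
        h.quadSum_mul_eq_zero hp hn.ne', zero_mul]

theorem quadSum_eq (hp : ‖p‖ < 1) {n : ℕ} (hd : d ≠ 0) (hden : quadDenom a q p n d ≠ 0) :
    quadSum a b q p n d = if Even n then quadValue a b q p (n / 2) d else 0 := by
  have e := h.quadNumer_eq hp n d hd
  rw [← quadSum_mul_quadDenom hden] at e
  split_ifs at e ⊢ with he
  · rw [← Nat.two_mul_div_two_of_even he] at hden e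
    rw [Nat.mul_div_cancel_left _ two_pos, ← quadValue_mul_quadDenom hp h.b_ne hd h.q_ne hden] at e
    rw [← mul_right_cancel₀ hden e, Nat.two_mul_div_two_of_even he]
  · exact (mul_eq_zero.1 e).resolve_right hden

end IsGeneric

/-! ### Removing genericity by perturbation -/

theorem countable_ellE_exp_eq_zero (hp : ‖p‖ < 1) {w c : ℂ} (hw : w ≠ 0) (hc : c ≠ 0) :
    {t : ℂ | ellE (w * Complex.exp (c * t)) p = 0}.Countable := by
  have hsub : {t : ℂ | ellE (w * Complex.exp (c * t)) p = 0} ⊆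
      ⋃ z ∈ {x : ℂ | x ≠ 0 ∧ ellE x p = 0},
        Set.range fun k : ℤ => (Complex.log (z / w) + k * (2 * Real.pi * Complex.I)) / c := by
    intro t ht
    have hz : w * Complex.exp (c * t) ≠ 0 := mul_ne_zero hw (Complex.exp_ne_zero _)
    refine Set.mem_biUnion (x := w * Complex.exp (c * t)) ⟨hz, ht⟩ ?_
    rw [mul_div_cancel_left₀ _ hw]
    obtain ⟨k, hk⟩ := Complex.exp_eq_exp_iff_exists_int.1
      (Complex.exp_log (Complex.exp_ne_zero (c * t))).symm
    exact ⟨k, by simp only [← hk]; field_simp⟩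
  exact ((countable_ellE_eq_zero hp).biUnion fun z _ => Set.countable_range _).mono hsub

/-- Each condition has the form `E(w e^{ct}) ≠ 0` with `c` equal to `k`, `i + k` or `2i + k` for an
integer `k`. The imaginary speeds on `a` and `b` keep `c` nonzero, so each condition excludes
countably many `t`. -/
theorem countable_not_isGeneric (hp : ‖p‖ < 1) (hq : q ≠ 0) (ha : a ≠ 0) (hb : b ≠ 0) :
    {t : ℂ | ¬ IsGeneric (a * Complex.exp (Complex.I * t)) (b * Complex.exp (2 * Complex.I * t))
      (q * Complex.exp t) p}.Countable := by
  have him : ∀ (r : ℝ) (k : ℤ), r ≠ 0 → (r * Complex.I + k : ℂ) ≠ 0 := fun r k hr h0 => hr (by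
    simpa using congrArg Complex.im h0)
  have hz : ∀ (k : ℤ) (t : ℂ), (q * Complex.exp t) ^ k = q ^ k * Complex.exp (k * t) := fun k t => by
    rw [mul_zpow, ← Complex.exp_int_mul]
  have hqk : ∀ k : ℤ, q ^ k ≠ 0 := fun k => zpow_ne_zero k hq
  have h1 : ∀ k : ℤ, {t : ℂ | k ≠ 0 ∧ ellE ((q * Complex.exp t) ^ k) p = 0}.Countable := fun k => by
    by_cases hk : k = 0
    · simp [hk]
    · refine (countable_ellE_exp_eq_zero hp (hqk k) (Int.cast_ne_zero.2 hk)).mono fun t ht => ?_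
      simpa only [Set.mem_ofPred_eq, hz] using ht.2
  have h2 : ∀ k : ℤ, {t : ℂ | ellE (a * Complex.exp (Complex.I * t) * (q * Complex.exp t) ^ k) p = 0}.Countable :=
    fun k => by
      refine (countable_ellE_exp_eq_zero hp (mul_ne_zero ha (hqk k)) (him 1 k one_ne_zero)).mono fun t ht => ?_
      rw [Set.mem_ofPred_eq, ← ht, hz, add_mul, Complex.exp_add, Complex.ofReal_one, one_mul]
      congr 1
      ring
  have h3 : ∀ k : ℤ, {t : ℂ | ellE (b * Complex.exp (2 * Complex.I * t) * (q * Complex.exp t) ^ k) p = 0}.Countable :=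
    fun k => by
      refine (countable_ellE_exp_eq_zero hp (mul_ne_zero hb (hqk k)) (him 2 k two_ne_zero)).mono fun t ht => ?_
      rw [Set.mem_ofPred_eq, ← ht, hz, add_mul, Complex.exp_add, Complex.ofReal_ofNat]
      congr 1
      ring
  have h4 : ∀ k : ℤ, {t : ℂ | ellE (b * Complex.exp (2 * Complex.I * t) / (a * Complex.exp (Complex.I * t)) *
      (q * Complex.exp t) ^ k) p = 0}.Countable :=
    fun k => by
      refine (countable_ellE_exp_eq_zero hp (mul_ne_zero (div_ne_zero hb ha) (hqk k))
        (him 1 k one_ne_zero)).mono fun t ht => ?_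
      rw [Set.mem_ofPred_eq, ← ht, hz, add_mul, Complex.exp_add, Complex.ofReal_one, one_mul,
        show 2 * Complex.I * t = Complex.I * t + Complex.I * t by ring, Complex.exp_add]
      congr 1
      have := Complex.exp_ne_zero (Complex.I * t)
      field_simp
  refine ((((Set.countable_iUnion h1).union (Set.countable_iUnion h2)).union
    (Set.countable_iUnion h3)).union (Set.countable_iUnion h4)).mono fun t ht => ?_
  by_contra hcon
  simp only [Set.mem_union, Set.mem_iUnion, Set.mem_ofPred_eq, not_or, not_exists, not_and] at hcon
  exact ht ⟨mul_ne_zero hq (Complex.exp_ne_zero _), mul_ne_zero ha (Complex.exp_ne_zero _),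
    mul_ne_zero hb (Complex.exp_ne_zero _), hcon.1.1.1, hcon.1.1.2, hcon.1.2, hcon.2⟩

theorem ContinuousAt.ellE (hp : ‖p‖ < 1) {x : ℂ → ℂ} {t₀ : ℂ} (hx : ContinuousAt x t₀) (h0 : x t₀ ≠ 0) :
    ContinuousAt (fun t => ellE (x t) p) t₀ :=
  ContinuousAt.comp (g := fun y => _root_.ellE y p) (f := x) (continuousAt_ellE hp h0) hx

theorem ContinuousAt.ellFact (hp : ‖p‖ < 1) {x s : ℂ → ℂ} {t₀ : ℂ} (hx : ContinuousAt x t₀)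
    (hs : ContinuousAt s t₀) (hx0 : x t₀ ≠ 0) (hs0 : s t₀ ≠ 0) (k : ℕ) :
    ContinuousAt (fun t => ellFact (x t) (s t) p k) t₀ :=
  tendsto_finsetProd _ fun j _ =>
    ContinuousAt.ellE hp (hx.mul (hs.pow j)) (mul_ne_zero hx0 (pow_ne_zero _ hs0))

theorem ellFact_ne_zero_of_le {x s : ℂ} {k n : ℕ} (hk : k ≤ n) (h : ellFact x s p n ≠ 0) :
    ellFact x s p k ≠ 0 :=
  ellFact_ne_zero_iff.2 fun j hj => ellFact_ne_zero_iff.1 h j (hj.trans_le hk)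

section Continuity

variable {A B Q : ℂ → ℂ} {t₀ : ℂ}

theorem continuousAt_quadSum (hp : ‖p‖ < 1) (hA : ContinuousAt A t₀) (hB : ContinuousAt B t₀)
    (hQ : ContinuousAt Q t₀) (hA0 : A t₀ ≠ 0) (hB0 : B t₀ ≠ 0) (hQ0 : Q t₀ ≠ 0) (hd : d ≠ 0) {n : ℕ}
    (hEa : ellE (A t₀) p ≠ 0) (h1 : ellFact (Q t₀) (Q t₀) p n ≠ 0)
    (h2 : ellFact (A t₀ * Q t₀ / B t₀) (Q t₀) p n ≠ 0) (h3 : ellFact (B t₀) (Q t₀) p n ≠ 0)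
    (h4 : ellFact (A t₀ * Q t₀ ^ (n + 2)) (Q t₀ ^ 2) p n ≠ 0) (h5 : quadDenom (A t₀) (Q t₀) p n d ≠ 0) :
    ContinuousAt (fun t => quadSum (A t) (B t) (Q t) p n d) t₀ := by
  unfold quadSum quadCoeff
  have hQ2 := pow_ne_zero 2 hQ0
  refine tendsto_finsetSum _ fun k hk => ?_
  have hk : k ≤ n := by have := Finset.mem_range.1 hk; omega
  have m1 := ellFact_ne_zero_of_le hk h1
  have m2 := ellFact_ne_zero_of_le hk h2
  have m3 := ellFact_ne_zero_of_le hk h3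
  have m4 := ellFact_ne_zero_of_le hk h4
  have m5 := ellFact_ne_zero_of_le hk (left_ne_zero_of_mul h5)
  have m6 := ellFact_ne_zero_of_le hk (right_ne_zero_of_mul h5)
  have hQn := pow_ne_zero n hQ0
  have cQ := hQ.pow 2
  have cAQ := (hA.mul hQ).div hB hB0
  have hAQ := div_ne_zero (mul_ne_zero hA0 hQ0) hB0
  have c1 := (ContinuousAt.ellE hp (hA.mul (hQ.pow (3 * k))) (mul_ne_zero hA0 (pow_ne_zero _ hQ0))).div
    (ContinuousAt.ellE hp hA hA0) hEa
  have c2 := (((ContinuousAt.ellFact hp hA cQ hA0 hQ2 k).mul (ContinuousAt.ellFact hp hB cQ hB0 hQ2 k)).mul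
    (ContinuousAt.ellFact hp cAQ cQ hAQ hQ2 k)).div
    (((ContinuousAt.ellFact hp hQ hQ hQ0 hQ0 k).mul (ContinuousAt.ellFact hp cAQ hQ hAQ hQ0 k)).mul
      (ContinuousAt.ellFact hp hB hQ hB0 hQ0 k)) (mul_ne_zero (mul_ne_zero m1 m2) m3)
  have c3 := (ContinuousAt.ellFact hp ((hQ.pow n).inv₀ hQn) hQ (inv_ne_zero hQn) hQ0 k).div
    (ContinuousAt.ellFact hp (hA.mul (hQ.pow (n + 2))) cQ (mul_ne_zero hA0 (pow_ne_zero _ hQ0)) hQ2 k) m4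
  have c4 := ((ContinuousAt.ellFact hp continuousAt_const hQ hd hQ0 k).mul
    (ContinuousAt.ellFact hp ((hA.mul (hQ.pow (n + 1))).div continuousAt_const hd) hQ
        (div_ne_zero (mul_ne_zero hA0 (pow_ne_zero _ hQ0)) hd) hQ0 k)).div
    ((ContinuousAt.ellFact hp (continuousAt_const.mul (hQ.div (hQ.pow n) hQn)) cQ
      (mul_ne_zero hd (div_ne_zero hQ0 hQn)) hQ2 k).mul
      (ContinuousAt.ellFact hp ((hA.mul cQ).div continuousAt_const hd) cQ
        (div_ne_zero (mul_ne_zero hA0 hQ2) hd) hQ2 k)) (mul_ne_zero m5 m6)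
  exact (((c1.mul c2).mul c3).mul (hQ.pow k)).mul c4

theorem continuousAt_quadDenom (hp : ‖p‖ < 1) (hA : ContinuousAt A t₀) (hQ : ContinuousAt Q t₀)
    (hA0 : A t₀ ≠ 0) (hQ0 : Q t₀ ≠ 0) (hd : d ≠ 0) (n : ℕ) :
    ContinuousAt (fun t => quadDenom (A t) (Q t) p n d) t₀ :=
  (ContinuousAt.ellFact hp (continuousAt_const.mul (hQ.div (hQ.pow n) (pow_ne_zero n hQ0))) (hQ.pow 2)
    (mul_ne_zero hd (div_ne_zero hQ0 (pow_ne_zero n hQ0))) (pow_ne_zero 2 hQ0) n).mul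
    (ContinuousAt.ellFact hp ((hA.mul (hQ.pow 2)).div continuousAt_const hd) (hQ.pow 2)
      (div_ne_zero (mul_ne_zero hA0 (pow_ne_zero 2 hQ0)) hd) (pow_ne_zero 2 hQ0) n)

theorem continuousAt_quadValue (hp : ‖p‖ < 1) (hA : ContinuousAt A t₀) (hB : ContinuousAt B t₀)
    (hQ : ContinuousAt Q t₀) (hA0 : A t₀ ≠ 0) (hB0 : B t₀ ≠ 0) (hQ0 : Q t₀ ≠ 0) (hd : d ≠ 0) {m : ℕ}
    (h2 : ellFact (A t₀ * Q t₀ / B t₀) (Q t₀) p (2 * m) ≠ 0) (h3 : ellFact (B t₀) (Q t₀) p (2 * m) ≠ 0)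
    (h5 : quadDenom (A t₀) (Q t₀) p (2 * m) d ≠ 0) :
    ContinuousAt (fun t => quadValue (A t) (B t) (Q t) p m d) t₀ := by
  have hQ2 := pow_ne_zero 2 hQ0
  have cQ := hQ.pow 2
  have cd : ContinuousAt (fun _ : ℂ => d) t₀ := continuousAt_const
  have hAQ := mul_ne_zero hA0 hQ2
  have m1 : ellFact (A t₀ * Q t₀ ^ 2 / B t₀) (Q t₀ ^ 2) p m ≠ 0 := ellFact_ne_zero_iff.2 fun k hk => by
    rw [show A t₀ * Q t₀ ^ 2 / B t₀ * (Q t₀ ^ 2) ^ k = A t₀ * Q t₀ / B t₀ * Q t₀ ^ (2 * k + 1) by ring]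
    exact ellFact_ne_zero_iff.1 h2 _ (by omega)
  have m2 : ellFact (B t₀ * Q t₀) (Q t₀ ^ 2) p m ≠ 0 := ellFact_ne_zero_iff.2 fun k hk => by
    rw [show B t₀ * Q t₀ * (Q t₀ ^ 2) ^ k = B t₀ * Q t₀ ^ (2 * k + 1) by ring]
    exact ellFact_ne_zero_iff.1 h3 _ (by omega)
  have m3 := ellFact_ne_zero_of_le (by omega : m ≤ 2 * m) (right_ne_zero_of_mul h5)
  -- This denominator does not occur in the sum; reversal relates it to the first half of a factor
  -- of `quadDenom`.
  have m4 : ellFact (Q t₀ / d) (Q t₀ ^ 2) p m ≠ 0 := by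
    have := ellFact_div_reverse (p := p) hp one_ne_zero hd hQ0 m
    rw [one_mul, one_pow, one_mul, div_one] at this
    rw [this]
    refine mul_ne_zero (Finset.prod_ne_zero_iff.2 fun k _ => by simp [hQ0, hd])
      (ellFact_ne_zero_of_le (by omega : m ≤ 2 * m) (left_ne_zero_of_mul h5))
  unfold quadValue
  refine ContinuousAt.div ?_ ?_ (mul_ne_zero (mul_ne_zero (mul_ne_zero m1 m2) m3) m4)
  · exact (((ContinuousAt.ellFact hp (hA.mul cQ) cQ hAQ hQ2 m).mul
      (ContinuousAt.ellFact hp hQ cQ hQ0 hQ2 m)).mul (ContinuousAt.ellFact hp ((hA.mul cQ).div (hB.mul cd)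
        (mul_ne_zero hB0 hd)) cQ (div_ne_zero hAQ (mul_ne_zero hB0 hd)) hQ2 m)).mul
      (ContinuousAt.ellFact hp ((hB.mul hQ).div cd hd) cQ (div_ne_zero (mul_ne_zero hB0 hQ0) hd) hQ2 m)
  · exact (((ContinuousAt.ellFact hp ((hA.mul cQ).div hB hB0) cQ (div_ne_zero hAQ hB0) hQ2 m).mul
      (ContinuousAt.ellFact hp (hB.mul hQ) cQ (mul_ne_zero hB0 hQ0) hQ2 m)).mul
      (ContinuousAt.ellFact hp ((hA.mul cQ).div cd hd) cQ (div_ne_zero hAQ hd) hQ2 m)).mul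
      (ContinuousAt.ellFact hp (hQ.div cd hd) cQ (div_ne_zero hQ0 hd) hQ2 m)

end Continuity

theorem quadSum_eq_of_ne_zero (hp : ‖p‖ < 1) (ha : a ≠ 0) (hb : b ≠ 0) (hq : q ≠ 0) (hd : d ≠ 0) {n : ℕ}
    (hEa : ellE a p ≠ 0) (h1 : ellFact q q p n ≠ 0)
    (h2 : ellFact (a * q / b) q p n ≠ 0) (h3 : ellFact b q p n ≠ 0)
    (h4 : ellFact (a * q ^ (n + 2)) (q ^ 2) p n ≠ 0) (h5 : quadDenom a q p n d ≠ 0) :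
    quadSum a b q p n d = if Even n then quadValue a b q p (n / 2) d else 0 := by
  let A : ℂ → ℂ := fun t => a * Complex.exp (Complex.I * t)
  let B : ℂ → ℂ := fun t => b * Complex.exp (2 * Complex.I * t)
  let Q : ℂ → ℂ := fun t => q * Complex.exp t
  have hA : ContinuousAt A 0 := by fun_prop
  have hB : ContinuousAt B 0 := by fun_prop
  have hQ : ContinuousAt Q 0 := by fun_prop
  have A0 : A 0 = a := by simp [A]
  have B0 : B 0 = b := by simp [B]
  have Q0 : Q 0 = q := by simp [Q]
  have c1 : ContinuousAt (fun t => quadSum (A t) (B t) (Q t) p n d) 0 := by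
    apply continuousAt_quadSum hp hA hB hQ <;> simpa only [A0, B0, Q0]
  have c2 : ContinuousAt (fun t => if Even n then quadValue (A t) (B t) (Q t) p (n / 2) d else 0) 0 := by
    by_cases he : Even n
    · simp only [he, if_true]
      rw [← Nat.two_mul_div_two_of_even he] at h2 h3 h5
      apply continuousAt_quadValue hp hA hB hQ <;> simpa only [A0, B0, Q0]
    · simp only [he, if_false]
      exact continuousAt_const
  have c3 : ContinuousAt (fun t => quadDenom (A t) (Q t) p n d) 0 := by
    apply continuousAt_quadDenom hp hA hQ <;> simpa only [A0, Q0]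
  have hev : ∀ᶠ t in 𝓝 (0 : ℂ), quadDenom (A t) (Q t) p n d ≠ 0 :=
    c3.eventually_ne (by simpa only [A0, Q0])
  have hdense : Dense {t : ℂ | IsGeneric (A t) (B t) (Q t) p} := by
    have := (countable_not_isGeneric (a := a) (b := b) hp hq ha hb).dense_compl ℂ
    simpa only [Set.compl_ofPred, not_not] using this
  -- Both sides agree at generic `t` near `0`, and `0` is a limit of such `t`, so their limits at
  -- `0` agree.
  have : (𝓝[{t : ℂ | IsGeneric (A t) (B t) (Q t) p}] (0 : ℂ)).NeBot :=
    mem_closure_iff_nhdsWithin_neBot.1 (hdense 0)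
  have heq := tendsto_nhds_unique_of_eventuallyEq
    (c1.tendsto.mono_left (nhdsWithin_le_nhds (s := {t : ℂ | IsGeneric (A t) (B t) (Q t) p})))
    (c2.tendsto.mono_left nhdsWithin_le_nhds) (by
      filter_upwards [self_mem_nhdsWithin, nhdsWithin_le_nhds hev] with t ht htd
      exact IsGeneric.quadSum_eq ht hp hd htd)
  simpa only [A0, B0, Q0] using heq

end QuadraticSum

theorem mainTheorem12 (a b c d e q p : ℂ) (n : ℕ)
    (hp : ‖p‖ < 1) (hq : q ≠ 0) (ha : a ≠ 0)
    (hbc : b * c = a * q) (hde : d * e = a * q ^ (n + 1))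
    -- no denominator in the sum vanishes
    (hEa : ellE a p ≠ 0)
    (hden₁ : ellFacts [q, a * q / b, a * q / c] q p n ≠ 0)
    (hden₂ : ellFacts [a * q ^ 2 / d, a * q ^ 2 / e, a * q ^ (n + 2)] (q ^ 2) p n ≠ 0) :
    (Even n → quadraticEllSum a b c d e q p n =
      ellFacts [a * q ^ 2, a * q ^ 2 / (b * c), a * q ^ 2 / (b * d), a * q ^ 2 / (c * d)]
          (q ^ 2) p (n / 2)
        / ellFacts [a * q ^ 2 / b, a * q ^ 2 / c, a * q ^ 2 / d, a * q ^ 2 / (b * c * d)]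
          (q ^ 2) p (n / 2)) ∧
    (Odd n → quadraticEllSum a b c d e q p n = 0) := by
  -- The two balancing relations force `b`, `c`, `d`, `e` to be nonzero, which permits solving for
  -- `c` and `e`.
  have hbc0 : b * c ≠ 0 := hbc ▸ mul_ne_zero ha hq
  have hde0 : d * e ≠ 0 := hde ▸ mul_ne_zero ha (pow_ne_zero _ hq)
  have hb := left_ne_zero_of_mul hbc0
  have hd := left_ne_zero_of_mul hde0
  obtain rfl : c = a * q / b := by rw [← hbc]; field_simp
  obtain rfl : e = a * q ^ (n + 1) / d := by rw [← hde]; field_simp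
  have e1 : a * q / (a * q / b) = b := by field_simp
  have e2 : a * q ^ 2 / (a * q ^ (n + 1) / d) = d * (q / q ^ n) := by field_simp; ring
  simp only [ellFacts, List.map_cons, List.map_nil, List.prod_cons, List.prod_nil, mul_one, e1, e2] at hden₁ hden₂
  have main := quadSum_eq_of_ne_zero hp ha hb hq hd hEa (left_ne_zero_of_mul hden₁)
    (left_ne_zero_of_mul (right_ne_zero_of_mul hden₁)) (right_ne_zero_of_mul (right_ne_zero_of_mul hden₁))
    (right_ne_zero_of_mul (right_ne_zero_of_mul hden₂))
    (mul_ne_zero (left_ne_zero_of_mul (right_ne_zero_of_mul hden₂)) (left_ne_zero_of_mul hden₂))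
  have hsum : quadraticEllSum a b (a * q / b) d (a * q ^ (n + 1) / d) q p n = quadSum a b q p n d := by
    refine Finset.sum_congr rfl fun k _ => ?_
    simp only [ellFacts, List.map_cons, List.map_nil, List.prod_cons, List.prod_nil, mul_one, e1, e2, quadCoeff]
    ring
  rw [hsum, main]
  constructor
  · intro he
    rw [if_pos he, quadValue]
    simp only [ellFacts, List.map_cons, List.map_nil, List.prod_cons, List.prod_nil, mul_one]
    rw [show a * q ^ 2 / (b * (a * q / b)) = q by field_simp,
      show a * q ^ 2 / (a * q / b * d) = b * q / d by field_simp,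
      show a * q ^ 2 / (a * q / b) = b * q by field_simp,
      show a * q ^ 2 / (b * (a * q / b) * d) = q / d by field_simp]
    simp only [mul_assoc]
  · intro ho
    rw [if_neg (Nat.not_even_iff_odd.2 ho)]
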